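/- Let $S^2\subset\mathbb R^3$ be the unit sphere with round metric $g$, area form $\mu$ (outward orientation), Laplace–Beltrami operator $\Delta$ and Poisson bracket $\{f,h\}\,\mu=\mathrm df\wedge\mathrm dh$ on $C^\infty(S^2)$. Let $\mathfrak X_\mu(S^2)$ be the Lie algebra of smooth divergence-free vector fields with the commutator, and let $X_\psi=\{\psi,\cdot\}\in\mathfrak X_\mu(S^2)$ be the field with stream function $\psi$. Let $\mathfrak f=\mathfrak X_\mu(S^2)\times C^\infty(S^2)$ be the Abelian extension with bracket $$[(v,\sigma),(w,\tau)]=\bigl([v,w],\;v(\tau)-w(\sigma)-\mu(v,w)\bigr),$$ so that $v(\sigma)=\{\psi,\sigma\}$ for $v=X_\psi$, and $\mu(X_\psi,X_\varphi)=\{\psi,\varphi\}$. Let $\mathfrak f^*$ be its smooth dual, consisting of the functionals $(v,\sigma)\mapsto\int_{S^2}(r\sigma+\theta(v))\mu$ with $r$ a smooth function and $\theta$ a smooth 1-form. Let $\mathcal F=\mathfrak f\ltimes\mathfrak f^*$ be the semidirect product with $$[(v,a),(w,c)]=([v,w],\,\mathrm{ad}^*_wa-\mathrm{ad}^*_vc),\qquad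 \langle\mathrm{ad}^*_x l,y\rangle=\langle l,[x,y]\rangle .$$ Its dual is $\mathcal F^*=\mathfrak f\times\mathfrak f^*$, with $\langle(w,b),(v,a)\rangle=b(v)+a(w)$. For $\kappa>0$ let $I_\kappa\colon\mathfrak f\to\mathfrak f^*$ be the operator $\langle I_\kappa(v,\sigma),(w,\tau)\rangle=\int_{S^2}(\kappa\,\sigma\tau+g(v,w))\,\mu$. For a function $h$ on $\mathcal F^*$, the differential of $h$ at $m$ is an element $\mathrm dh(m)\in\mathcal F$ with $\frac{\mathrm d}{\mathrm ds}\big|_{s=0}h(m+s\delta)=\langle\delta,\mathrm dh(m)\rangle$ for all $\delta\in\mathcal F^*$. A curve $m(t)\in\mathcal F^*$ is a trajectory of the Lie–Poisson system with Hamiltonian $h$ if $\dot m=\mathrm{ad}^*_{\mathrm dh(m)}m$, that is, $\frac{\mathrm d}{\mathrm dt}\langle m,y\rangle=\langle m,[\mathrm dh(m),y]\rangle$ for all $y\in\mathcal F$. **Theorem.** Let $J\subset\mathbb R$ be an open interval and let $\psi,\rho,q,\xi\colon J\times S^2\to\mathbb R$ be smooth. Consider the system of axisymmetric MHD equations on $J\times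 S^2$ $$\begin{aligned} \Delta\dot\psi&=\{\Delta\psi,\psi\}+\{\xi,\Delta\xi\}+2\{q,\psi\}+2\{\xi,\rho\},&\qquad \dot\rho&=\{\rho,\psi\}+\{\xi,q\}+2\{\psi,\xi\},\\ \dot q&=\{q,\psi\}+\{\xi,\rho\},& \dot\xi&=\{\xi,\psi\}. \end{aligned}\tag{LP3D}$$ 1. (Lie–Poisson form.) Let $h(w,b)=\tfrac12\langle I_4w,w\rangle+\tfrac12\langle b,I_4^{-1}b\rangle$ on $\mathcal F^*$, where the second term means $\sup_{v\in\mathfrak f}\bigl(b(v)-\tfrac12\langle I_4v,v\rangle\bigr)$. Then $(\psi,\rho,q,\xi)$ solves (LP3D) if and only if the curve $m=\bigl((X_\xi,\tfrac12\rho),\,I_4(X_\psi,\tfrac12 q)\bigr)$ in $\mathcal F^*$ is a trajectory of the Lie–Poisson system with Hamiltonian $h$ and $\int_{S^2}\xi\,\mu$ is constant in time. (The last condition is only there because $X_\xi$ determines $\xi$ up to an additive constant.) Moreover, for every quadruple $(\psi,\rho,q,\xi)$ as above and every $t\in J$, $h(m)$ is the energy $$H=-\tfrac12\int_{S^2}(\psi\Delta\psi-q^2)\mu-\tfrac12\int_{S^2}(\xi\Delta\xi-\rho^2)\mu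 .$$ 2. (Euler–Arnold form.) $(\psi,\rho,q,\xi)$ solves (LP3D) if and only if $\int_{S^2}\xi\,\mu$ is constant in time and $\frac{\mathrm d}{\mathrm dt}m=\mathrm{ad}^*_{x}m$ on $\mathcal F^*$ (tested against every $y\in\mathcal F$), where $m=\bigl((X_\xi,\rho),\,I_1(X_\psi,q)\bigr)$ and $x=\bigl((X_\beta,\alpha),\,I_1(X_\delta,\gamma)\bigr)\in\mathcal F$ with $\beta=\psi$, $\delta=\xi$, $\alpha=q-\psi$, $\gamma=\rho+\xi$. -/

import Mathlib

open MeasureTheory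
open scoped Manifold ContDiff

namespace AxiMHD

noncomputable section

abbrev E3 := EuclideanSpace ℝ (Fin 3)
/-- The unit sphere `S²` in `ℝ³`. -/
abbrev S2 := Metric.sphere (0 : E3) 1
/-- The algebra `C^∞(S²)`. -/
abbrev SmoothFn := C^∞⟮𝓡 2, S2; ℝ⟯

/-- The standard basis of `ℝ³`. -/
def ebasis (i : Fin 3) : E3 := EuclideanSpace.single i 1

open Classical in
/-- The extension `y ↦ f(y / |y|)` of `f` from `S²` to `ℝ³ ∖ {0}`. -/
def radialExt (f : S2 → ℝ) (y : E3) : ℝ :=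
  if h : y = 0 then 0 else f ⟨‖y‖⁻¹ • y, by simp [norm_smul, h]⟩

theorem radialExt_coe (f : S2 → ℝ) (x : S2) : radialExt f x = f x := by
  have hx : ‖(x : E3)‖ = 1 := norm_eq_of_mem_sphere x
  have h0 : (x : E3) ≠ 0 := by
    intro h; simp [h] at hx
  simp only [radialExt, h0, dif_neg, not_false_eq_true]
  congr 1
  ext1
  simp [hx]

theorem radialExt_smul (f : S2 → ℝ) {c : ℝ} (hc : 0 < c) (y : E3) : radialExt f (c • y) = radialExt f y := by
  by_cases h : y = 0
  · simp [h]
  · have h' : c • y ≠ 0 := smul_ne_zero hc.ne' h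
    simp only [radialExt, h, h', dif_neg, not_false_eq_true]
    congr 1
    ext1
    simp only [norm_smul, Real.norm_eq_abs, abs_of_pos hc, smul_smul]
    congr 1
    field_simp

theorem contDiffAt_radialExt (f : SmoothFn) {y : E3} (hy : y ≠ 0) : ContDiffAt ℝ ∞ (radialExt f) y := by
  have : Fact (Module.finrank ℝ E3 = 2 + 1) := ⟨by simp⟩
  let U : TopologicalSpace.Opens E3 := ⟨{0}ᶜ, isOpen_compl_singleton⟩
  have hN : ContMDiff 𝓘(ℝ, E3) 𝓘(ℝ, E3) ∞ (fun z : U => ‖(z : E3)‖⁻¹ • (z : E3)) := by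
    intro z
    have hz : (z : E3) ≠ 0 := z.2
    refine (contMDiffAt_subtype_iff (f := fun z : E3 => ‖z‖⁻¹ • z)).2 ?_
    refine ContDiffAt.contMDiffAt ?_
    exact ((contDiffAt_norm ℝ hz).inv (norm_ne_zero_iff.2 hz)).smul contDiffAt_id
  have hmem : ∀ z : U, ‖(z : E3)‖⁻¹ • (z : E3) ∈ Metric.sphere (0 : E3) 1 := by
    intro z
    have hz : (z : E3) ≠ 0 := z.2
    simp [norm_smul, hz]
  have hc := f.contMDiff.comp (ContMDiff.codRestrict_sphere (n := 2) hN hmem)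
  have h2 : ContMDiffAt 𝓘(ℝ, E3) 𝓘(ℝ, ℝ) ∞ (fun z : U => radialExt f z) ⟨y, hy⟩ := by
    convert! hc.contMDiffAt using 1
    funext z
    have hz : (z : E3) ≠ 0 := z.2
    simp [radialExt, hz, Set.codRestrict]
  exact (contMDiffAt_subtype_iff.1 h2).contDiffAt

theorem coe_ne_zero (x : S2) : (x : E3) ≠ 0 := by
  intro h
  have := norm_eq_of_mem_sphere x
  simp [h] at this

/-- The restriction to `S²` of a function on `ℝ³` that is smooth near `S²`. -/
def ofAmbient (g : E3 → ℝ) (hg : ∀ x : S2, ContDiffAt ℝ ∞ g x) : SmoothFn :=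
  have : Fact (Module.finrank ℝ E3 = 2 + 1) := ⟨by simp⟩
  ⟨fun x => g x, fun x => ((hg x).contMDiffAt.comp x contMDiff_coe_sphere.contMDiffAt)⟩

@[simp] theorem ofAmbient_apply (g : E3 → ℝ) (hg : ∀ x : S2, ContDiffAt ℝ ∞ g x) (x : S2) :
    ofAmbient g hg x = g x := rfl

theorem radialExt_add (f g : SmoothFn) : radialExt (⇑f + ⇑g) = radialExt f + radialExt g := by
  funext y; by_cases h : y = 0 <;> simp [radialExt, h]
theorem radialExt_mul (f g : SmoothFn) : radialExt (⇑f * ⇑g) = radialExt f * radialExt g := by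
  funext y; by_cases h : y = 0 <;> simp [radialExt, h]
theorem radialExt_const_smul (c : ℝ) (f : SmoothFn) : radialExt (c • ⇑f) = c • radialExt f := by
  funext y; by_cases h : y = 0 <;> simp [radialExt, h]
theorem differentiableAt_radialExt (f : SmoothFn) (x : S2) : DifferentiableAt ℝ (radialExt f) x :=
  (contDiffAt_radialExt f (coe_ne_zero x)).differentiableAt (by simp)

/-- The `i`-th component of the tangential gradient on `S²`: the restriction to `S²` of the `i`-th
partial derivative of the radially constant extension. -/
def D (i : Fin 3) : Derivation ℝ SmoothFn SmoothFn :=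
  Derivation.mk'
    { toFun := fun f => ofAmbient (fun y => fderiv ℝ (radialExt f) y (ebasis i)) fun x =>
        ((contDiffAt_radialExt f (coe_ne_zero x)).fderiv_right (m := ∞) (by simp)).clm_apply
          contDiffAt_const
      map_add' := fun f g => by
        ext x
        simp [radialExt_add, fderiv_add (differentiableAt_radialExt f x) (differentiableAt_radialExt g x)]
      map_smul' := fun c f => by
        ext x
        simp [radialExt_const_smul, fderiv_const_smul (differentiableAt_radialExt f x)] }
    (fun f g => by
      ext x
      simp [radialExt_mul, fderiv_mul (differentiableAt_radialExt f x) (differentiableAt_radialExt g x), radialExt_coe])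

theorem D_apply (i : Fin 3) (f : SmoothFn) (x : S2) :
    D i f x = fderiv ℝ (radialExt f) x (ebasis i) := rfl

/-- The restriction to `S²` of the `i`-th coordinate function of `ℝ³`. -/
def coord (i : Fin 3) : SmoothFn :=
  ofAmbient (fun y => y i) fun x => by fun_prop

theorem fderiv_radialExt_smul (f : SmoothFn) {c : ℝ} (hc : 0 < c) (y : E3) :
    fderiv ℝ (radialExt f) (c • y) = c⁻¹ • fderiv ℝ (radialExt f) y := by
  have h : (fun z => radialExt f (c • z)) = radialExt f := funext fun z => radialExt_smul f hc z
  have h2 := fderiv_comp_smul (f := radialExt f) c (x := y)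
  rw [h] at h2
  rw [h2, smul_smul, inv_mul_cancel₀ hc.ne', one_smul]

theorem radialExt_ofAmbient (g : E3 → ℝ) (hg : ∀ x : S2, ContDiffAt ℝ ∞ g x) {y : E3} (hy : y ≠ 0) :
    radialExt ⇑(ofAmbient g hg) y = g (‖y‖⁻¹ • y) := by
  simp [radialExt, hy]

theorem radialExt_D (i : Fin 3) (f : SmoothFn) {y : E3} (hy : y ≠ 0) :
    radialExt ⇑(D i f) y = ‖y‖ * fderiv ℝ (radialExt f) y (ebasis i) := by
  have h := radialExt_ofAmbient (fun y => fderiv ℝ (radialExt f) y (ebasis i)) (fun x =>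
        ((contDiffAt_radialExt f (coe_ne_zero x)).fderiv_right (m := ∞) (by simp)).clm_apply
          contDiffAt_const) hy
  refine h.trans ?_
  rw [fderiv_radialExt_smul f (by positivity)]
  simp

theorem sum_coord_mul_D (f : SmoothFn) : ∑ i, coord i * D i f = 0 := by
  ext x
  have h1 : HasDerivAt (fun s : ℝ => radialExt f (s • (x : E3))) (fderiv ℝ (radialExt f) x x) 1 := by
    have := (differentiableAt_radialExt f x).hasFDerivAt
    have h2 : HasDerivAt (fun s : ℝ => s • (x : E3)) (x : E3) 1 := by
      simpa using (hasDerivAt_id (1:ℝ)).smul_const (x : E3)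
    exact HasFDerivAt.comp_hasDerivAt (1:ℝ) (by simpa using this) h2
  have h3 : HasDerivAt (fun s : ℝ => radialExt f (s • (x : E3))) 0 1 := by
    refine (hasDerivAt_const (1:ℝ) (radialExt f x)).congr_of_eventuallyEq ?_
    filter_upwards [lt_mem_nhds (show (0:ℝ) < 1 by norm_num)] with s hs
    exact radialExt_smul f hs _
  have h4 := h1.unique h3
  have h5 : (x : E3) = ∑ i, (x : E3) i • ebasis i := by
    ext j; fin_cases j <;> simp [ebasis, Fin.sum_univ_three]
  have h6 : fderiv ℝ (radialExt f) x (∑ i, (x : E3) i • ebasis i) = 0 := by rw [← h5]; exact h4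
  rw [map_sum] at h6
  simp only [map_smul, smul_eq_mul] at h6
  simpa [coord, D_apply, Fin.sum_univ_three] using h6

theorem sum_coord_sq : ∑ i, coord i * coord i = 1 := by
  ext x
  have := norm_eq_of_mem_sphere x
  rw [EuclideanSpace.norm_eq, Real.sqrt_eq_one] at this
  simpa [coord, Fin.sum_univ_three, sq] using this

theorem fderiv_norm_apply (x : S2) :
    HasFDerivAt (fun y : E3 => ‖y‖) (innerSL ℝ (x : E3)) (x : E3) := by
  have h := (hasStrictFDerivAt_norm_sq (x : E3)).hasFDerivAt.sqrt (by simp)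
  simp only [norm_nonneg, Real.sqrt_sq] at h
  convert! h using 1
  ext y
  simp [norm_eq_of_mem_sphere x]

theorem D_coord (i j : Fin 3) :
    D i (coord j) = (if i = j then 1 else 0) - coord i * coord j := by
  ext x
  have hx := norm_eq_of_mem_sphere x
  have he : radialExt ⇑(coord j) =ᶠ[nhds (x : E3)] fun y => ‖y‖⁻¹ * y j := by
    filter_upwards [isOpen_ne.mem_nhds (coe_ne_zero x)] with y hy
    simp [coord, radialExt, hy]
  have h1 : HasFDerivAt (fun y : E3 => ‖y‖⁻¹) (-(innerSL ℝ (x : E3))) (x : E3) := by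
    have := (hasDerivAt_inv (by simp [hx] : ‖(x:E3)‖ ≠ 0)).comp_hasFDerivAt (x:E3)
      (fderiv_norm_apply x)
    simpa [hx] using! this
  have h2 : HasFDerivAt (fun y : E3 => y j) (EuclideanSpace.proj j : E3 →L[ℝ] ℝ) (x : E3) :=
    (EuclideanSpace.proj j : E3 →L[ℝ] ℝ).hasFDerivAt
  have h3 := ((h1.mul h2).congr_of_eventuallyEq he).fderiv
  rw [D_apply, h3]
  by_cases hij : i = j
  · subst hij
    simp [ebasis, hx, coord, EuclideanSpace.inner_single_right]; ring
  · simp [ebasis, hx, coord, EuclideanSpace.inner_single_right, hij, Ne.symm hij]; ring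

theorem D_comm (i j : Fin 3) (f : SmoothFn) :
    D i (D j f) - D j (D i f) = coord i * D j f - coord j * D i f := by
  ext x
  have hx := norm_eq_of_mem_sphere x
  have hC := contDiffAt_radialExt f (coe_ne_zero x)
  have hd : DifferentiableAt ℝ (fderiv ℝ (radialExt f)) (x : E3) :=
    (hC.fderiv_right (m := ∞) (by simp)).differentiableAt (by simp)
  have key : ∀ i j : Fin 3, D i (D j f) x = (x : E3) i * D j f x
      + fderiv ℝ (fderiv ℝ (radialExt f)) x (ebasis i) (ebasis j) := by
    intro i j
    have he : radialExt ⇑(D j f) =ᶠ[nhds (x : E3)] fun y => ‖y‖ * fderiv ℝ (radialExt f) y (ebasis j) := by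
      filter_upwards [isOpen_ne.mem_nhds (coe_ne_zero x)] with y hy
      exact radialExt_D j f hy
    have h2 : HasFDerivAt (fun y : E3 => fderiv ℝ (radialExt f) y (ebasis j))
        ((fderiv ℝ (fderiv ℝ (radialExt f)) x).flip (ebasis j)) (x : E3) := by
      simpa using! hd.hasFDerivAt.clm_apply (hasFDerivAt_const (ebasis j) (x : E3))
    have h3 := (((fderiv_norm_apply x).mul h2).congr_of_eventuallyEq he).fderiv
    rw [D_apply, h3, D_apply]
    simp [ebasis, hx, EuclideanSpace.inner_single_right]; ring
  have hs : fderiv ℝ (fderiv ℝ (radialExt f)) x (ebasis i) (ebasis j)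
      = fderiv ℝ (fderiv ℝ (radialExt f)) x (ebasis j) (ebasis i) :=
    (hC.isSymmSndFDerivAt (by simpa using (mod_cast le_top : ((2 : ℕ∞) : WithTop ℕ∞) ≤ ((⊤ : ℕ∞) : WithTop ℕ∞)))).eq _ _
  simp only [ContMDiffMap.coe_sub, ContMDiffMap.coe_mul, Pi.sub_apply, Pi.mul_apply, key, hs]
  simp [coord]

/-- The Riemannian area measure `μ` of the unit sphere. -/
def area : Measure S2 := (volume : Measure E3).toSphere

instance : IsFiniteMeasure area := inferInstanceAs (IsFiniteMeasure (volume : Measure E3).toSphere)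

theorem integrable_area (f : SmoothFn) : Integrable f area :=
  (f.contMDiff.continuous).integrable_of_hasCompactSupport
    (HasCompactSupport.of_compactSpace f)

/-- `f ↦ ∫ f μ` on `C^∞(S²)`. -/
def integ : SmoothFn →ₗ[ℝ] ℝ where
  toFun f := ∫ x, f x ∂area
  map_add' f g := by
    simpa using integral_add (integrable_area f) (integrable_area g)
  map_smul' c f := by
    simpa using integral_const_mul c _

/-- A bump function on the line, supported near `1`. -/
def cut : ContDiffBump (1 : ℝ) := ⟨1/4, 1/2, by norm_num, by norm_num⟩

/-- A smooth radial function with compact support in `ℝ³ ∖ {0}`. -/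
def cutoff (y : E3) : ℝ := cut (‖y‖ ^ 2)

theorem cutoff_contDiff : ContDiff ℝ ∞ cutoff := cut.contDiff.comp (contDiff_norm_sq ℝ)

theorem cutoff_zero_near : ∀ᶠ y in nhds (0 : E3), cutoff y = 0 := by
  have : Filter.Tendsto (fun y : E3 => ‖y‖ ^ 2) (nhds 0) (nhds 0) := by
    have : Continuous (fun y : E3 => ‖y‖ ^ 2) := by fun_prop
    simpa using this.tendsto 0
  filter_upwards [this.eventually (gt_mem_nhds (show (0:ℝ) < 1/2 by norm_num))] with y hy
  apply cut.zero_of_le_dist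
  rw [Real.dist_eq, abs_sub_comm]
  refine le_trans ?_ (le_abs_self _)
  change (1/2 : ℝ) ≤ _
  linarith

theorem cutoff_hcs : HasCompactSupport cutoff := by
  refine HasCompactSupport.intro (isCompact_closedBall (0 : E3) 2) fun y hy => ?_
  apply cut.zero_of_le_dist
  simp only [Metric.mem_closedBall, dist_zero_right, not_le] at hy
  rw [Real.dist_eq]
  refine le_trans ?_ (le_abs_self _)
  change (1/2 : ℝ) ≤ _
  nlinarith

theorem contDiff_cut_mul (g : E3 → ℝ) (hg : ∀ y ≠ 0, ContDiffAt ℝ ∞ g y) :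
    ContDiff ℝ ∞ (fun y => cutoff y * g y) := by
  rw [contDiff_iff_contDiffAt]
  intro y
  by_cases h : y = 0
  · subst h
    refine (contDiffAt_const (c := (0:ℝ))).congr_of_eventuallyEq ?_
    filter_upwards [cutoff_zero_near] with z hz
    simp [hz]
  · exact cutoff_contDiff.contDiffAt.mul (hg y h)

theorem cutoff_polar (f : SmoothFn) :
    ∫ y, cutoff y * radialExt f y
      = integ f * ∫ r : Set.Ioi (0:ℝ), cut ((r : ℝ)^2) ∂(Measure.volumeIoiPow 2) := by
  have h := (volume : Measure E3).measurePreserving_homeomorphUnitSphereProd.integral_comp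
        (Homeomorph.measurableEmbedding _)
        (fun p : S2 × Set.Ioi (0:ℝ) => f p.1 * cut ((p.2 : ℝ)^2))
  have h3 : Module.finrank ℝ E3 - 1 = 2 := by simp
  rw [h3] at h
  calc
    _ = ∫ y : ({(0)}ᶜ : Set E3), cutoff y * radialExt f y ∂((volume : Measure E3).comap (↑)) := by
      rw [integral_subtype_comap (measurableSet_singleton _).compl
        fun y => cutoff y * radialExt f y, restrict_compl_singleton]
    _ = _ := by
      refine Eq.trans ?_ (h.trans (integral_prod_mul (μ := area)
        (ν := Measure.volumeIoiPow 2) (fun x => f x) (fun r : Set.Ioi (0:ℝ) => cut ((r:ℝ)^2))))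
      refine integral_congr_ae (Filter.Eventually.of_forall fun y => ?_)
      have hy : (y : E3) ≠ 0 := y.2
      simp only [radialExt, hy, dif_neg, not_false_eq_true, cutoff]
      rw [mul_comm]
      congr 1
      · congr 1
        ext1
        simp
      · simp

theorem polar_const_ne : ∫ r : Set.Ioi (0:ℝ), cut ((r : ℝ)^2) ∂(Measure.volumeIoiPow 2) ≠ 0 := by
  intro h0
  have h := cutoff_polar 1
  rw [h0, mul_zero] at h
  have hs : (fun y => cutoff y * radialExt ⇑(1 : SmoothFn) y) = cutoff := by
    funext y
    by_cases hy : y = 0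
    · subst hy; simp [cutoff_zero_near.self_of_nhds]
    · simp [radialExt, hy]
  rw [hs] at h
  have hpos : 0 < ∫ y, cutoff y := by
    refine cutoff_contDiff.continuous.integral_pos_of_hasCompactSupport_nonneg_nonzero
      cutoff_hcs (fun y => cut.nonneg) (x := ebasis 0) ?_
    have : cutoff (ebasis 0) = 1 := by
      simp only [cutoff, ebasis, PiLp.norm_single, norm_one, one_pow]
      exact cut.one_of_mem_closedBall (by simp [cut])
    rw [this]; exact one_ne_zero
  linarith

theorem integral_coord_mul_fderiv (F : E3 → ℝ) (hF : ContDiff ℝ ∞ F) (hc : HasCompactSupport F)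
    (a b : Fin 3) (hab : a ≠ b) : ∫ y : E3, y a * fderiv ℝ F y (ebasis b) = 0 := by
  have hp : ∀ y : E3, HasFDerivAt (fun y : E3 => y a) (EuclideanSpace.proj a : E3 →L[ℝ] ℝ) y :=
    fun y => (EuclideanSpace.proj a : E3 →L[ℝ] ℝ).hasFDerivAt
  have hz : ∀ y : E3, fderiv ℝ (fun y : E3 => y a) y (ebasis b) = 0 := by
    intro y
    rw [(hp y).fderiv]
    simp [ebasis, hab]
  have hca : Continuous fun y : E3 => y a := by fun_prop
  have h := integral_mul_fderiv_eq_neg_fderiv_mul_of_integrable (μ := (volume : Measure E3))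
    (f := fun y : E3 => y a) (g := F) (v := ebasis b) (by simp [hz])
    ((hca.mul ((hF.continuous_fderiv (by simp)).clm_apply continuous_const)).integrable_of_hasCompactSupport
      ((hc.fderiv_apply (𝕜 := ℝ) (ebasis b)).mul_left))
    ((hca.mul hF.continuous).integrable_of_hasCompactSupport hc.mul_left)
    (fun y _ => (hp y).differentiableAt)
    (fun y _ => hF.differentiable (by simp) y)
  simpa [hz] using h

theorem integrable_coord_mul_fderiv (F : E3 → ℝ) (hF : ContDiff ℝ ∞ F) (hc : HasCompactSupport F)
    (a b : Fin 3) : Integrable (fun y : E3 => y a * fderiv ℝ F y (ebasis b)) := by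
  have hca : Continuous fun y : E3 => y a := by fun_prop
  exact ((hca.mul ((hF.continuous_fderiv (by simp)).clm_apply continuous_const)).integrable_of_hasCompactSupport
      ((hc.fderiv_apply (𝕜 := ℝ) (ebasis b)).mul_left))

theorem integ_rot (f : SmoothFn) (a b : Fin 3) (hab : a ≠ b) :
    integ (coord a * D b f - coord b * D a f) = 0 := by
  set F : E3 → ℝ := fun y => cutoff y * radialExt f y with hFdef
  have hF : ContDiff ℝ ∞ F := contDiff_cut_mul _ fun y hy => contDiffAt_radialExt f hy
  have hc : HasCompactSupport F := cutoff_hcs.mul_right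
  have h1 : ∫ y : E3, (y a * fderiv ℝ F y (ebasis b) - y b * fderiv ℝ F y (ebasis a)) = 0 := by
    rw [integral_sub (integrable_coord_mul_fderiv F hF hc a b)
      (integrable_coord_mul_fderiv F hF hc b a), integral_coord_mul_fderiv F hF hc a b hab,
      integral_coord_mul_fderiv F hF hc b a hab.symm, sub_zero]
  have h2 : (fun y : E3 => y a * fderiv ℝ F y (ebasis b) - y b * fderiv ℝ F y (ebasis a))
      = fun y => cutoff y * radialExt ⇑(coord a * D b f - coord b * D a f) y := by
    funext y
    by_cases hy : y = 0
    · subst hy; simp [cutoff_zero_near.self_of_nhds]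
    · have hd : DifferentiableAt ℝ (radialExt f) y :=
        (contDiffAt_radialExt f hy).differentiableAt (by simp)
      have hcd : HasFDerivAt cutoff ((deriv cut (‖y‖^2)) • (2 • (innerSL ℝ y))) y := by
        have hd1 : DifferentiableAt ℝ cut (‖y‖^2) :=
          (cut.contDiff (n := (⊤ : ℕ∞))).differentiable (by simp) _
        exact hd1.hasDerivAt.comp_hasFDerivAt y (hasStrictFDerivAt_norm_sq y).hasFDerivAt
      have h3 : ∀ i, fderiv ℝ F y (ebasis i) = cutoff y * fderiv ℝ (radialExt f) y (ebasis i)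
          + radialExt f y * (deriv cut (‖y‖^2) * (2 * y i)) := by
        intro i
        have h5 : HasFDerivAt F _ y := hcd.mul hd.hasFDerivAt
        rw [h5.fderiv]
        simp [ebasis, EuclideanSpace.inner_single_right]
      have h4 : radialExt ⇑(coord a * D b f - coord b * D a f) y
          = y a * fderiv ℝ (radialExt f) y (ebasis b) - y b * fderiv ℝ (radialExt f) y (ebasis a) := by
        have hn : ‖y‖ ≠ 0 := norm_ne_zero_iff.2 hy
        have ha := radialExt_D a f hy
        have hb := radialExt_D b f hy
        simp only [radialExt, hy, dif_neg, not_false_eq_true] at ha hb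
        simp only [radialExt, hy, dif_neg, not_false_eq_true, ContMDiffMap.coe_sub,
          ContMDiffMap.coe_mul, Pi.sub_apply, Pi.mul_apply, ha, hb]
        simp [coord]
        field_simp
      rw [h3, h3, h4]
      ring
  rw [h2, cutoff_polar] at h1
  exact (mul_eq_zero.1 h1).resolve_right polar_const_ne

/-- The Riemannian gradient on `S²`, as a vector in `ℝ³` with smooth components. -/
def grad (f : SmoothFn) : Fin 3 → SmoothFn := fun i => D i f

/-- The Poisson bracket `{f, h} μ = df ∧ dh` on `S²`, i.e. `{f, h}(x) = x · (∇f(x) × ∇h(x))`. -/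
def poisson (f h : SmoothFn) : SmoothFn := coord ⬝ᵥ (crossProduct (grad f) (grad h))

/-- The Laplace–Beltrami operator on `S²`. -/
def lap (f : SmoothFn) : SmoothFn := ∑ i, D i (D i f)

/-- The vector field `x × ∇ψ`, as a derivation; it is `f ↦ {ψ, f}` by `hamDer_apply`. -/
def hamDer (ψ : SmoothFn) : Derivation ℝ SmoothFn SmoothFn :=
  ∑ i, crossProduct coord (grad ψ) i • D i

theorem hamDer_apply (ψ f : SmoothFn) : hamDer ψ f = poisson ψ f := by
  simp only [hamDer, poisson, Fin.sum_univ_three, Derivation.coe_add, Pi.add_apply,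
    Derivation.coe_smul, Pi.smul_apply, smul_eq_mul, crossProduct, LinearMap.mk₂_apply,
    Matrix.vec3_dotProduct, grad, Matrix.cons_val_zero, Matrix.cons_val_one, Matrix.cons_val]
  ring

/-- The components `v(xᵢ)` of a vector field `v` on `S²`, seen as a tangent vector in `ℝ³`. -/
def comp (v : Derivation ℝ SmoothFn SmoothFn) (i : Fin 3) : SmoothFn := v (coord i)

theorem sum_coord_comp (v : Derivation ℝ SmoothFn SmoothFn) : ∑ i, coord i * comp v i = 0 := by
  have h := congrArg v sum_coord_sq
  simp only [Fin.sum_univ_three, map_add, Derivation.leibniz, smul_eq_mul,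
    Derivation.map_one_eq_zero] at h
  have h2 : (2:ℝ) • ∑ i, coord i * comp v i = 0 := by
    rw [← h]; simp only [comp, Fin.sum_univ_three, two_smul]; ring
  exact (smul_eq_zero.1 h2).resolve_left two_ne_zero

theorem comp_lie (v w : Derivation ℝ SmoothFn SmoothFn) (i : Fin 3) :
    comp ⁅v, w⁆ i = v (comp w i) - w (comp v i) := by
  simp [comp, Derivation.commutator_apply]

/-- `v` acts on functions as the directional derivative along the smooth tangent vector field with
components `v(xᵢ)`. -/
def IsVectorField (v : Derivation ℝ SmoothFn SmoothFn) : Prop :=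
  ∀ f, v f = ∑ i, comp v i * D i f

theorem IsVectorField.lie {v w : Derivation ℝ SmoothFn SmoothFn} (hv : IsVectorField v)
    (hw : IsVectorField w) : IsVectorField ⁅v, w⁆ := by
  intro f
  have e := fun i j => D_comm i j f
  have hV := sum_coord_comp v
  have hW := sum_coord_comp w
  simp only [Fin.sum_univ_three] at hV hW
  have hvi : ∀ i, v (D i f) = ∑ j, comp v j * D j (D i f) := fun i => hv (D i f)
  have hwi : ∀ i, w (D i f) = ∑ j, comp w j * D j (D i f) := fun i => hw (D i f)
  rw [Derivation.commutator_apply, hw f, hv f]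
  simp only [Fin.sum_univ_three, map_add, Derivation.leibniz, smul_eq_mul, hvi, hwi, comp_lie]
  have e01 := e 0 1
  have e02 := e 0 2
  have e12 := e 1 2
  generalize comp v 0 = V0 at *
  generalize comp v 1 = V1 at *
  generalize comp v 2 = V2 at *
  generalize comp w 0 = W0 at *
  generalize comp w 1 = W1 at *
  generalize comp w 2 = W2 at *
  linear_combination (V0 * W1 - V1 * W0) * e01 + (V0 * W2 - V2 * W0) * e02
    + (V1 * W2 - V2 * W1) * e12 + (W0 * D 0 f + W1 * D 1 f + W2 * D 2 f) * hV
    - (V0 * D 0 f + V1 * D 1 f + V2 * D 2 f) * hW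

theorem integ_poisson (ψ f : SmoothFn) : integ (poisson ψ f) = 0 := by
  have h : poisson ψ f =
      (coord 2 * D 0 (f * D 1 ψ) - coord 0 * D 2 (f * D 1 ψ)) * (-1)
      + (coord 1 * D 2 (f * D 0 ψ) - coord 2 * D 1 (f * D 0 ψ)) * (-1)
      + (coord 0 * D 1 (f * D 2 ψ) - coord 1 * D 0 (f * D 2 ψ)) * (-1) := by
    have e01 := D_comm 0 1 ψ
    have e02 := D_comm 0 2 ψ
    have e12 := D_comm 1 2 ψ
    simp only [poisson, crossProduct, LinearMap.mk₂_apply,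
      Matrix.vec3_dotProduct, grad, Matrix.cons_val_zero, Matrix.cons_val_one, Matrix.cons_val,
      Derivation.leibniz, smul_eq_mul]
    linear_combination f * (coord 2 * e01 - coord 1 * e02 + coord 0 * e12)
  rw [h]
  simp only [mul_neg_one, map_add, map_neg, integ_rot _ _ _ (show (2 : Fin 3) ≠ 0 by decide),
    integ_rot _ _ _ (show (1 : Fin 3) ≠ 2 by decide),
    integ_rot _ _ _ (show (0 : Fin 3) ≠ 1 by decide), neg_zero, add_zero]

/-- The Lie algebra `X_μ(S²)` of smooth area-preserving (divergence-free) vector fields on `S²`, with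
the commutator of vector fields: `∫ v(f) μ = 0` for all smooth `f` says that `v` has divergence `0`. -/
def divFree : LieSubalgebra ℝ (Derivation ℝ SmoothFn SmoothFn) where
  carrier := {v | IsVectorField v ∧ ∀ f, integ (v f) = 0}
  add_mem' := by
    rintro v w ⟨hv, hv'⟩ ⟨hw, hw'⟩
    refine ⟨fun f => ?_, fun f => by simp [hv', hw']⟩
    simp [comp, add_mul, Finset.sum_add_distrib, hv f, hw f]
  zero_mem' := ⟨fun f => by simp [comp], fun f => by simp⟩
  smul_mem' := by
    rintro c v ⟨hv, hv'⟩
    refine ⟨fun f => ?_, fun f => by simp [hv']⟩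
    simp [comp, hv f, Finset.smul_sum]
  lie_mem' := by
    rintro v w ⟨hv, hv'⟩ ⟨hw, hw'⟩
    refine ⟨hv.lie hw, fun f => ?_⟩
    simp [Derivation.commutator_apply, hv', hw']

theorem comp_hamDer (ψ : SmoothFn) (i : Fin 3) :
    comp (hamDer ψ) i = (crossProduct coord (grad ψ)) i := by
  simp only [comp, hamDer_apply, poisson, Matrix.vec3_dotProduct, crossProduct,
    LinearMap.mk₂_apply, grad, D_coord]
  fin_cases i <;> simp <;> ring

theorem hamDer_isVectorField (ψ : SmoothFn) : IsVectorField (hamDer ψ) := by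
  intro f
  simp only [comp_hamDer]
  simp [hamDer, Fin.sum_univ_three]

/-- The Hamiltonian vector field `X_ψ = {ψ, ·}` with stream function `ψ`, as an element of `X_μ(S²)`. -/
def ham (ψ : SmoothFn) : divFree :=
  ⟨hamDer ψ, hamDer_isVectorField ψ, fun f => by rw [hamDer_apply, integ_poisson]⟩

theorem ham_lie (ψ σ : SmoothFn) : ⁅ham ψ, σ⁆ = poisson ψ σ := hamDer_apply ψ σ

/-- The area form `μ(v, w)`, i.e. `x · (v(x) × w(x))`. -/
def areaForm (v w : divFree) : SmoothFn := coord ⬝ᵥ (crossProduct (comp v) (comp w))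

theorem areaForm_ham (ψ φ : SmoothFn) : areaForm (ham ψ) (ham φ) = poisson ψ φ := by
  have hx := sum_coord_sq
  simp only [Fin.sum_univ_three] at hx
  simp only [areaForm, ham, poisson, Matrix.vec3_dotProduct, crossProduct, LinearMap.mk₂_apply,
    comp_hamDer, Matrix.cons_val_zero, Matrix.cons_val_one, Matrix.cons_val]
  generalize coord 0 = x0 at *
  generalize coord 1 = x1 at *
  generalize coord 2 = x2 at *
  linear_combination (x0 * (grad ψ 1 * grad φ 2 - grad ψ 2 * grad φ 1)
    + x1 * (grad ψ 2 * grad φ 0 - grad ψ 0 * grad φ 2)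
    + x2 * (grad ψ 0 * grad φ 1 - grad ψ 1 * grad φ 0)) * hx

open LieModule.Cohomology

theorem triple_zero (u v w : Derivation ℝ SmoothFn SmoothFn) :
    comp u ⬝ᵥ (crossProduct (comp v) (comp w)) = 0 := by
  have hx := sum_coord_sq
  have hu := sum_coord_comp u
  have hv := sum_coord_comp v
  have hw := sum_coord_comp w
  simp only [Fin.sum_univ_three] at hx hu hv hw
  simp only [Matrix.vec3_dotProduct, crossProduct, LinearMap.mk₂_apply,
    Matrix.cons_val_zero, Matrix.cons_val_one, Matrix.cons_val]
  generalize coord 0 = x0 at *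
  generalize coord 1 = x1 at *
  generalize coord 2 = x2 at *
  generalize comp u 0 = u0 at *
  generalize comp u 1 = u1 at *
  generalize comp u 2 = u2 at *
  generalize comp v 0 = v0 at *
  generalize comp v 1 = v1 at *
  generalize comp v 2 = v2 at *
  generalize comp w 0 = w0 at *
  generalize comp w 1 = w1 at *
  generalize comp w 2 = w2 at *
  have c0 : x0 * (u0 * (v1 * w2 - v2 * w1) + u1 * (v2 * w0 - v0 * w2) + u2 * (v0 * w1 - v1 * w0)) = 0 := by
    linear_combination (v1 * w2 - v2 * w1) * hu + (w1 * u2 - w2 * u1) * hv + (u1 * v2 - u2 * v1) * hw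
  have c1 : x1 * (u0 * (v1 * w2 - v2 * w1) + u1 * (v2 * w0 - v0 * w2) + u2 * (v0 * w1 - v1 * w0)) = 0 := by
    linear_combination (v2 * w0 - v0 * w2) * hu + (w2 * u0 - w0 * u2) * hv + (u2 * v0 - u0 * v2) * hw
  have c2 : x2 * (u0 * (v1 * w2 - v2 * w1) + u1 * (v2 * w0 - v0 * w2) + u2 * (v0 * w1 - v1 * w0)) = 0 := by
    linear_combination (v0 * w1 - v1 * w0) * hu + (w0 * u1 - w1 * u0) * hv + (u0 * v1 - u1 * v0) * hw
  linear_combination x0 * c0 + x1 * c1 + x2 * c2 - (u0 * (v1 * w2 - v2 * w1) + u1 * (v2 * w0 - v0 * w2) + u2 * (v0 * w1 - v1 * w0)) * hx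

theorem areaForm_eq (v w : divFree) : areaForm v w =
    coord 0 * (comp v 1 * comp w 2 - comp v 2 * comp w 1)
    + coord 1 * (comp v 2 * comp w 0 - comp v 0 * comp w 2)
    + coord 2 * (comp v 0 * comp w 1 - comp v 1 * comp w 0) := by
  simp only [areaForm, Matrix.vec3_dotProduct, crossProduct, LinearMap.mk₂_apply,
    Matrix.cons_val_zero, Matrix.cons_val_one, Matrix.cons_val]

theorem comp_add (v w : divFree) (i : Fin 3) : comp ↑(v + w) i = comp v i + comp w i := rfl

theorem comp_smul (c : ℝ) (v : divFree) (i : Fin 3) : comp ↑(c • v) i = c • comp v i := rfl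

/-- `b(v, w) = -μ(v, w)`, i.e. `b(X_ψ, X_φ) = -{ψ, φ}` by `areaForm_ham`. -/
def cochain : twoCochain ℝ divFree SmoothFn :=
  ⟨LinearMap.mk₂ ℝ (fun v w => -areaForm v w)
      (fun u v w => by simp only [areaForm_eq, comp_add]; ring)
      (fun c u v => by
        simp only [areaForm_eq, comp_smul, Algebra.smul_def]; ring)
      (fun u v w => by simp only [areaForm_eq, comp_add]; ring)
      (fun c u v => by
        simp only [areaForm_eq, comp_smul, Algebra.smul_def]; ring),
    fun v => by simp only [LinearMap.mk₂_apply, areaForm_eq]; ring⟩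

theorem cochain_apply (v w : divFree) : cochain v w = -areaForm v w := rfl

theorem cochain_mem : cochain ∈ twoCocycle ℝ divFree SmoothFn := by
  rw [mem_twoCocycle_iff]
  refine LinearMap.ext fun u => LinearMap.ext fun v => LinearMap.ext fun w => ?_
  have h := triple_zero u v w
  simp only [Matrix.vec3_dotProduct, crossProduct, LinearMap.mk₂_apply,
    Matrix.cons_val_zero, Matrix.cons_val_one, Matrix.cons_val] at h
  have hl : ∀ (a : divFree) (f : SmoothFn), ⁅a, f⁆ = (a : Derivation ℝ SmoothFn SmoothFn) f :=
    fun a f => rfl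
  have hc : ∀ (a : Derivation ℝ SmoothFn SmoothFn) i, a (coord i) = comp a i := fun _ _ => rfl
  simp only [d₂₃_apply, cochain_apply, areaForm_eq, LinearMap.zero_apply, hl,
    LieSubalgebra.coe_bracket, comp_lie, map_neg, map_add, map_sub, Derivation.leibniz,
    smul_eq_mul, hc]
  linear_combination (-3) * h

/-- The cocycle `b`. -/
def cocycle : twoCocycle ℝ divFree SmoothFn := ⟨cochain, cochain_mem⟩

/-- The Abelian extension `f = X_μ(S²) × C^∞(S²)` of `X_μ(S²)` by its module `C^∞(S²)`, on which `v`
acts by `σ ↦ v(σ)`, with the cocycle `b`: the bracket is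
`[(v, σ), (w, τ)] = ([v, w], v(τ) - w(σ) + b(v, w))`, see `AbelianExt.lie_eq`. -/
abbrev AbelianExt : Type := LieAlgebra.ofTwoCocycle cocycle

namespace AbelianExt

def mk (v : divFree) (σ : SmoothFn) : AbelianExt := LieAlgebra.ofProd cocycle (v, σ)

def vf (x : AbelianExt) : divFree := x.carrier.1

def fn (x : AbelianExt) : SmoothFn := x.carrier.2

@[simp] theorem vf_mk (v : divFree) (σ : SmoothFn) : (mk v σ).vf = v := rfl
@[simp] theorem fn_mk (v : divFree) (σ : SmoothFn) : (mk v σ).fn = σ := rfl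
@[simp] theorem vf_add (x y : AbelianExt) : (x + y).vf = x.vf + y.vf := rfl
@[simp] theorem fn_add (x y : AbelianExt) : (x + y).fn = x.fn + y.fn := rfl
@[simp] theorem vf_smul (c : ℝ) (x : AbelianExt) : (c • x).vf = c • x.vf := rfl
@[simp] theorem fn_smul (c : ℝ) (x : AbelianExt) : (c • x).fn = c • x.fn := rfl

theorem lie_eq (x y : AbelianExt) :
    ⁅x, y⁆ = mk ⁅x.vf, y.vf⁆ (⁅x.vf, y.fn⁆ - ⁅y.vf, x.fn⁆ - areaForm x.vf y.vf) := by
  have h : -areaForm x.vf y.vf + ⁅x.vf, y.fn⁆ - ⁅y.vf, x.fn⁆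
      = ⁅x.vf, y.fn⁆ - ⁅y.vf, x.fn⁆ - areaForm x.vf y.vf := by abel
  rw [← h]
  rfl

end AbelianExt

/-- `⟨(v, σ), (w, τ)⟩ = ∫ (κ σ τ + g(v, w)) μ` on `f`, where `g` is the round metric. As a map from
`f` to its algebraic dual it is an inertia operator. -/
def inertia (κ : ℝ) : AbelianExt →ₗ[ℝ] Module.Dual ℝ AbelianExt :=
  LinearMap.mk₂ ℝ
    (fun x y => integ (κ • (x.fn * y.fn) + ∑ i, comp x.vf i * comp y.vf i))
    (fun x y z => by
      rw [← map_add]; congr 1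
      simp only [AbelianExt.fn_add, AbelianExt.vf_add, comp_add, Fin.sum_univ_three,
        Algebra.smul_def]
      ring)
    (fun c x y => by
      rw [← map_smul]; congr 1
      simp only [AbelianExt.fn_smul, AbelianExt.vf_smul, comp_smul, Fin.sum_univ_three,
        Algebra.smul_def]
      ring)
    (fun x y z => by
      rw [← map_add]; congr 1
      simp only [AbelianExt.fn_add, AbelianExt.vf_add, comp_add, Fin.sum_univ_three,
        Algebra.smul_def]
      ring)
    (fun c x y => by
      rw [← map_smul]; congr 1
      simp only [AbelianExt.fn_smul, AbelianExt.vf_smul, comp_smul, Fin.sum_univ_three,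
        Algebra.smul_def]
      ring)

theorem integ_lie (v : divFree) (f : SmoothFn) : integ ((v : Derivation ℝ SmoothFn SmoothFn) f) = 0 :=
  v.2.2 f

/-- The smooth dual `f*`: functionals `(v, σ) ↦ ∫ (r σ + θ(v)) μ` with a smooth function `r` and a
smooth 1-form `θ = ∑ aᵢ dxᵢ`. It is a submodule of the coadjoint module, on which `x` acts by
`(x • l)(y) = -l([x, y])`, i.e. by `-ad*_x`. -/
def smoothDual : LieSubmodule ℝ AbelianExt (Module.Dual ℝ AbelianExt) where
  carrier := {l | ∃ (r : SmoothFn) (a : Fin 3 → SmoothFn), ∀ x : AbelianExt,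
    l x = integ (r * x.fn + ∑ i, a i * comp x.vf i)}
  add_mem' := by
    rintro l m ⟨r, a, h⟩ ⟨r', a', h'⟩
    refine ⟨r + r', a + a', fun x => ?_⟩
    rw [LinearMap.add_apply, h, h', ← map_add]
    congr 1
    simp only [Fin.sum_univ_three, Pi.add_apply]
    ring
  zero_mem' := ⟨0, 0, fun x => by simp⟩
  smul_mem' := by
    rintro c l ⟨r, a, h⟩
    refine ⟨c • r, c • a, fun x => ?_⟩
    rw [LinearMap.smul_apply, h, ← map_smul]
    congr 1
    simp only [Fin.sum_univ_three, Pi.smul_apply, Algebra.smul_def]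
    ring
  lie_mem := by
    rintro x l ⟨r, a, h⟩
    refine ⟨⁅x.vf, r⁆, fun j => r * crossProduct coord (comp x.vf) j + r * D j x.fn
      + ⁅x.vf, a j⁆ + ∑ i, a i * D j (comp x.vf i), fun y => ?_⟩
    rw [Module.Dual.lie_apply, h, AbelianExt.lie_eq, neg_eq_iff_add_eq_zero, ← map_add]
    have hl : ∀ (v : divFree) (f : SmoothFn), ⁅v, f⁆ = (v : Derivation ℝ SmoothFn SmoothFn) f :=
      fun v f => rfl
    have hd := y.vf.2.1
    refine Eq.trans ?_ (integ_lie x.vf (r * y.fn + ∑ i, a i * comp y.vf i))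
    congr 1
    simp only [AbelianExt.fn_mk, AbelianExt.vf_mk, hl, hd x.fn, areaForm_eq, Fin.sum_univ_three,
      LieSubalgebra.coe_bracket, comp_lie, hd (comp _ _), map_add, Derivation.leibniz, smul_eq_mul,
      crossProduct, LinearMap.mk₂_apply, Matrix.cons_val_zero, Matrix.cons_val_one, Matrix.cons_val]
    ring

theorem inertia_mem (κ : ℝ) (x : AbelianExt) : inertia κ x ∈ smoothDual :=
  ⟨κ • x.fn, comp x.vf, fun y => by simp [inertia]⟩

/-- The inertia operator `f → f*`. -/
def inertiaOp (κ : ℝ) (x : AbelianExt) : smoothDual := ⟨inertia κ x, inertia_mem κ x⟩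

/-- The magnetic extension `F = f ⋉ f*`, the semidirect product of `f` and the coadjoint module (the
extension with zero cocycle): `[(v, a), (w, c)] = ([v, w], ad*_w a - ad*_v c)`, see
`MagneticExt.lie_eq`. -/
abbrev MagneticExt : Type := LieAlgebra.ofTwoCocycle (0 : twoCocycle ℝ AbelianExt smoothDual)

namespace MagneticExt

def mk (v : AbelianExt) (a : smoothDual) : MagneticExt := LieAlgebra.ofProd 0 (v, a)

def fst (y : MagneticExt) : AbelianExt := y.carrier.1

def snd (y : MagneticExt) : smoothDual := y.carrier.2

theorem lie_eq (x y : MagneticExt) :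
    ⁅x, y⁆ = mk ⁅x.fst, y.fst⁆ (⁅x.fst, y.snd⁆ - ⁅y.fst, x.snd⁆) := by
  refine (LieAlgebra.bracket_ofTwoCocycle x y).trans ?_
  refine congrArg (fun z => LieAlgebra.ofProd _ (⁅x.fst, y.fst⁆, z - ⁅y.fst, x.snd⁆)) ?_
  exact zero_add (⁅x.fst, y.snd⁆ : smoothDual)

end MagneticExt

/-- The dual `F* = f × f*` of `F = f ⋉ f*`; its elements are written `(w, b)`. -/
abbrev MagneticDual : Type := AbelianExt × smoothDual

/-- The duality between `F*` and `F`: `⟨(w, b), (v, a)⟩ = b(v) + a(w)`. -/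
def pairing (m : MagneticDual) (y : MagneticExt) : ℝ :=
  (m.2 : Module.Dual ℝ AbelianExt) y.fst + (y.snd : Module.Dual ℝ AbelianExt) m.1

/-- `∂ₜ m = ad*_x m` on the time set `J`, where `⟨ad*_x m, y⟩ = ⟨m, [x, y]⟩` for all `y` in `F`. -/
def IsEulerArnoldCurve (J : Set ℝ) (m : ℝ → MagneticDual) (x : ℝ → MagneticExt) : Prop :=
  ∀ t ∈ J, ∀ y : MagneticExt,
    HasDerivAt (fun s => pairing (m s) y) (pairing (m t) ⁅x t, y⁆) t

/-- `x`, an element of `F`, is the differential of `h : F* → ℝ` at the point `m`. -/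
def IsDifferentialAt (h : MagneticDual → ℝ) (m : MagneticDual) (x : MagneticExt) : Prop :=
  ∀ δ : MagneticDual, HasDerivAt (fun s : ℝ => h (m + s • δ)) (pairing δ x) 0

/-- `m` is a trajectory, on the time set `J`, of the Lie–Poisson system on `F*` with Hamiltonian
`h`: `∂ₜ m = ad*_{dh(m)} m`. -/
def IsLiePoissonCurve (h : MagneticDual → ℝ) (J : Set ℝ) (m : ℝ → MagneticDual) : Prop :=
  ∃ x : ℝ → MagneticExt, (∀ t ∈ J, IsDifferentialAt h (m t) (x t)) ∧ IsEulerArnoldCurve J m x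

/-- The Hamiltonian `h(w, b) = ½ ⟨I w, w⟩ + ½ ⟨b, I⁻¹ b⟩` on `F*`, with the inertia operator
`I = inertia 4`, i.e. with the inner product `∫ (4 σ σ' + g(v, v')) μ` on `f`. The second summand
is written as the Legendre transform of `v ↦ ½ ⟨I v, v⟩`, which avoids inverting `I`. -/
def hamiltonian (m : MagneticDual) : ℝ :=
  1 / 2 * inertia 4 m.1 m.1
    + ⨆ v : AbelianExt, ((m.2 : Module.Dual ℝ AbelianExt) v - 1 / 2 * inertia 4 v v)

/-- The point `(B, I u)` of `F*`, where `u = (X_ψ, q/2)`, `B = (X_ξ, ρ/2)` and `I = inertia 4`,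
so that `I u` is the functional `(v, σ) ↦ ∫ (2 q σ + g(X_ψ, v)) μ`. -/
def momentum (ψ ρ q ξ : SmoothFn) : MagneticDual :=
  (AbelianExt.mk (ham ξ) ((1 / 2 : ℝ) • ρ),
    inertiaOp 4 (AbelianExt.mk (ham ψ) ((1 / 2 : ℝ) • q)))

/-- The point `((ρ, ξ), (q, ψ))` of `F*`, where `(q, ψ)` is identified with an element of `f*`
by the pairing `∫ (q α + g(X_ψ, X_β)) μ = ∫ (q α - ψ Δβ) μ`. -/
def coalgebraFields (ψ ρ q ξ : SmoothFn) : MagneticDual :=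
  (AbelianExt.mk (ham ξ) ρ, inertiaOp 1 (AbelianExt.mk (ham ψ) q))

/-- The element `((α, β), (γ, δ))` of `F`, where `(γ, δ)` is identified with an element of `f*`
by the same pairing. -/
def algebraFields (α β γ δ : SmoothFn) : MagneticExt :=
  MagneticExt.mk (AbelianExt.mk (ham β) α) (inertiaOp 1 (AbelianExt.mk (ham δ) γ))

/-- The energy `-½ ∫ (ψ Δψ - q²) μ - ½ ∫ (ξ Δξ - ρ²) μ`. -/
def energy (ψ ρ q ξ : SmoothFn) : ℝ :=
  -(1 / 2) * integ (ψ * lap ψ - q ^ 2) - 1 / 2 * integ (ξ * lap ξ - ρ ^ 2)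

/-- `(t, x) ↦ u t x` is smooth on `J × S²`. -/
def SmoothInTime (J : Set ℝ) (u : ℝ → SmoothFn) : Prop :=
  ContMDiffOn (𝓘(ℝ, ℝ).prod (𝓡 2)) 𝓘(ℝ, ℝ) ∞ (fun p : ℝ × S2 => u p.1 p.2) (J ×ˢ Set.univ)

/-- The system of axisymmetric MHD equations, holding at all times in `J` and all points of `S²`:
`∂ₜ Δψ = {Δψ, ψ} + {ξ, Δξ} + 2 {q, ψ} + 2 {ξ, ρ}`, `∂ₜ ρ = {ρ, ψ} + {ξ, q} + 2 {ψ, ξ}`,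
`∂ₜ q = {q, ψ} + {ξ, ρ}`, `∂ₜ ξ = {ξ, ψ}`. -/
def SolvesAxisymmetricMHD (J : Set ℝ) (ψ ρ q ξ : ℝ → SmoothFn) : Prop :=
  ∀ t ∈ J, ∀ x : S2,
    HasDerivAt (fun s => lap (ψ s) x)
      ((poisson (lap (ψ t)) (ψ t) + poisson (ξ t) (lap (ξ t))
        + 2 * poisson (q t) (ψ t) + 2 * poisson (ξ t) (ρ t)) x) t ∧
    HasDerivAt (fun s => ρ s x)
      ((poisson (ρ t) (ψ t) + poisson (ξ t) (q t) + 2 * poisson (ψ t) (ξ t)) x) t ∧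
    HasDerivAt (fun s => q s x) ((poisson (q t) (ψ t) + poisson (ξ t) (ρ t)) x) t ∧
    HasDerivAt (fun s => ξ s x) (poisson (ξ t) (ψ t) x) t

end

end AxiMHD

/-! Both parts are weak formulations of the same four equations. For smooth time-dependent functions
a pointwise evolution equation is equivalent to its integrated form against every smooth function
(`SmoothAmbient.forall_hasDerivAt_iff`), so it suffices to see which test functions an element of
`MagneticExt` supplies.

Every divergence-free field on the sphere is Hamiltonian (`exists_ham`, resting on the exactness of
closed 1-forms), and an element of the smooth dual acts on pairs (`X_ξ`, ρ) by integration against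
two functions r and c (`smoothDual_ham`). Thus `y` amounts to test functions (φ, τ, r, c). By
`pairing_ham` the pairing with `m` is a sum of four integrals, one for each unknown. By
`pairing_lie_ham`, which uses the cyclic invariance of ∫ f{g,h} and Green's formula, the pairing
with the bracket is the same sum with each unknown replaced by the right-hand side of its equation.
The functions φ, τ and r are arbitrary, but c has mean zero, being a divergence up to sign; this is
why the mean of ξ needs a separate condition. The result is `isEulerArnoldCurve_iff`, with κ and the
components α, γ left free.

Part 2 is the case κ = 1 with the shifts α = q − ψ, γ = ρ + ξ. For part 1, `h` is a quadratic form: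
translating the variable in the Legendre transform completes the square and makes `h` an exact
quadratic polynomial along every line through (w, I u). Its differential there is (u, I w), uniquely
so by definiteness of I. Hence the Lie–Poisson equation is the Euler–Arnold equation with κ = 4, α =
q/2, γ = ρ/2, and the value of `h` is the energy. -/

namespace AxiMHD

/-! ### Integration by parts on the sphere. -/

section Integration

theorem integ_D (i : Fin 3) (f : SmoothFn) : integ (D i f) = integ (2 * coord i * f) := by
  have hrot : ∀ a b (g : SmoothFn), integ (coord a * D b g - coord b * D a g) = 0 := by
    intro a b g
    by_cases h : a = b
    · simp [h]
    · exact integ_rot g a b h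
  -- The difference is a sum of rotation fields applied to the functions `coord a * f`, and
  -- rotations preserve area. The 2 is the trace of the tangential projection, Σ (1 − xₐ²).
  have h : D i f - 2 * coord i * f
      = ∑ a, (coord a * D i (coord a * f) - coord i * D a (coord a * f)) := by
    have hx := sum_coord_sq
    have hf := sum_coord_mul_D f
    fin_cases i <;>
    · simp [Fin.sum_univ_three, D_coord] at hx hf ⊢
      first
      | linear_combination -D 0 f * hx + coord 0 * hf
      | linear_combination -D 1 f * hx + coord 1 * hf
      | linear_combination -D 2 f * hx + coord 2 * hf
  have h2 : integ (D i f - 2 * coord i * f) = 0 := by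
    rw [h, map_sum]
    exact Finset.sum_eq_zero fun a _ => hrot a i _
  rwa [map_sub, sub_eq_zero] at h2

/-- Integration by parts. -/
theorem integ_mul_D (i : Fin 3) (f g : SmoothFn) :
    integ (f * D i g) = integ (g * (2 * coord i * f - D i f)) := by
  have h := integ_D i (f * g)
  rw [Derivation.leibniz] at h
  simp only [smul_eq_mul, map_add] at h
  rw [mul_sub, map_sub]
  have e : g * (2 * coord i * f) = 2 * coord i * (f * g) := by ring
  rw [e]
  linarith

theorem eq_zero_of_integ_sq {f : SmoothFn} (h : integ (f * f) = 0) : f = 0 := by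
  have hc : Continuous f := f.contMDiff.continuous
  have h2 : (fun x => (f * f) x) = fun _ => (0:ℝ) := by
    have hi := integrable_area (f * f)
    have h3 := (integral_eq_zero_iff_of_nonneg (μ := area) (f := fun x => (f * f) x)
      (fun x => mul_self_nonneg (f x)) hi).1 h
    have : Measure.IsOpenPosMeasure area :=
      inferInstanceAs (Measure.IsOpenPosMeasure (volume : Measure E3).toSphere)
    exact (f * f).contMDiff.continuous.ae_eq_iff_eq area continuous_const |>.1 h3
  ext x
  exact mul_self_eq_zero.1 (congrFun h2 x)

theorem eq_of_forall_integ_mul {f g : SmoothFn} (h : ∀ φ, integ (φ * f) = integ (φ * g)) :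
    f = g := by
  rw [← sub_eq_zero]
  apply eq_zero_of_integ_sq
  rw [mul_sub, map_sub, h, sub_self]

theorem integ_nonneg {f : SmoothFn} (h : ∀ x, 0 ≤ f x) : 0 ≤ integ f := integral_nonneg h

theorem integ_mono {f g : SmoothFn} (h : ∀ x, f x ≤ g x) : integ f ≤ integ g :=
  integral_mono (integrable_area f) (integrable_area g) h

/-- Green's formula. The curvature term from `integ_D` pairs the normal with a tangential gradient,
so it vanishes. -/
theorem integ_mul_lap (ψ φ : SmoothFn) :
    integ (φ * lap ψ) = -integ (∑ i, D i ψ * D i φ) := by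
  have hψ := sum_coord_mul_D ψ
  have h : ∀ i, integ (φ * D i (D i ψ))
      = integ (2 * φ * (coord i * D i ψ)) - integ (D i ψ * D i φ) := by
    intro i
    have e := integ_D i (φ * D i ψ)
    rw [Derivation.leibniz, smul_eq_mul, smul_eq_mul, map_add] at e
    rw [show 2 * φ * (coord i * D i ψ) = 2 * coord i * (φ * D i ψ) by ring, ← e]
    ring
  simp only [lap, Finset.mul_sum, map_sum, h]
  rw [Finset.sum_sub_distrib, ← map_sum, ← Finset.mul_sum, hψ]
  simp

theorem integ_mul_lap_comm (ψ φ : SmoothFn) : integ (φ * lap ψ) = integ (ψ * lap φ) := by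
  rw [integ_mul_lap, integ_mul_lap]
  simp only [mul_comm]

end Integration

/-! ### Algebra of the Poisson bracket and Hamiltonian fields. -/

section Poisson

theorem poisson_eq (f h : SmoothFn) : poisson f h =
    coord 0 * (D 1 f * D 2 h - D 2 f * D 1 h) + coord 1 * (D 2 f * D 0 h - D 0 f * D 2 h)
      + coord 2 * (D 0 f * D 1 h - D 1 f * D 0 h) := by
  simp only [poisson, Matrix.vec3_dotProduct, crossProduct, LinearMap.mk₂_apply, grad,
    Matrix.cons_val_zero, Matrix.cons_val_one, Matrix.cons_val]

theorem poisson_antisymm (f h : SmoothFn) : poisson f h = -poisson h f := by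
  simp only [poisson_eq]; ring

theorem poisson_add_left (f g h : SmoothFn) : poisson (f + g) h = poisson f h + poisson g h := by
  simp only [poisson_eq, map_add]; ring

theorem poisson_sub_left (f g h : SmoothFn) : poisson (f - g) h = poisson f h - poisson g h := by
  simp only [poisson_eq, map_sub]; ring

theorem poisson_smul_left (c : ℝ) (f h : SmoothFn) : poisson (c • f) h = c • poisson f h := by
  simp only [poisson_eq, Derivation.map_smul]
  simp only [Algebra.smul_def]
  ring

theorem poisson_add_right (f g h : SmoothFn) : poisson f (g + h) = poisson f g + poisson f h := by
  simp only [poisson_eq, map_add]; ring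

theorem poisson_sub_right (f g h : SmoothFn) : poisson f (g - h) = poisson f g - poisson f h := by
  simp only [poisson_eq, map_sub]; ring

theorem poisson_smul_right (c : ℝ) (f h : SmoothFn) : poisson f (c • h) = c • poisson f h := by
  simp only [poisson_eq, Derivation.map_smul]
  simp only [Algebra.smul_def]
  ring

theorem poisson_self (f : SmoothFn) : poisson f f = 0 := by
  simp only [poisson_eq]; ring

theorem poisson_mul_left (f g h : SmoothFn) :
    poisson (f * g) h = f * poisson g h + g * poisson f h := by
  simp only [poisson_eq, Derivation.leibniz, smul_eq_mul]; ring

/-- Leibniz rule applied to ∫ {fg, h} = 0. This cyclic symmetry is what moves brackets off the test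
functions. -/
theorem integ_mul_poisson (f g h : SmoothFn) :
    integ (f * poisson g h) = integ (g * poisson h f) := by
  have e := integ_poisson (f * g) h
  rw [poisson_mul_left, map_add] at e
  rw [poisson_antisymm h f, mul_neg, map_neg]
  linarith

theorem ham_coe_apply (ψ f : SmoothFn) :
    (ham ψ : Derivation ℝ SmoothFn SmoothFn) f = poisson ψ f := hamDer_apply ψ f

theorem divFree_ext {v w : divFree} (h : ∀ i, comp v i = comp w i) : v = w := by
  apply Subtype.ext
  ext1 f
  rw [v.2.1 f, w.2.1 f]
  simp only [h]

/-- Triple product expansion: x · (v × (x × ∇f)) = |x|² (v · ∇f) − (x · ∇f)(x · v), where |x| = 1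
and v is tangent. -/
theorem areaForm_ham_right (v : divFree) (f : SmoothFn) :
    areaForm v (ham f) = (v : Derivation ℝ SmoothFn SmoothFn) f := by
  have hx := sum_coord_sq
  have hv := sum_coord_comp v
  have hf := sum_coord_mul_D f
  rw [v.2.1 f]
  simp only [Fin.sum_univ_three] at hx hv hf ⊢
  simp only [areaForm_eq, ham, comp_hamDer, crossProduct, LinearMap.mk₂_apply, grad,
    Matrix.cons_val_zero, Matrix.cons_val_one, Matrix.cons_val]
  linear_combination (comp v 0 * D 0 f + comp v 1 * D 1 f + comp v 2 * D 2 f) * hx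
    - (coord 0 * D 0 f + coord 1 * D 1 f + coord 2 * D 2 f) * hv

/-- The cocycle identity for the area form, evaluated on three Hamiltonian fields, is the Jacobi
identity up to antisymmetry, so no second derivatives need to be computed. -/
theorem poisson_jacobi (f g h : SmoothFn) :
    poisson f (poisson g h) - poisson g (poisson f h) = poisson (poisson f g) h := by
  have hc := cochain_mem
  rw [LieModule.Cohomology.mem_twoCocycle_iff] at hc
  have e := congrArg (fun T => T (ham f) (ham g) (ham h)) hc
  have hl : ∀ (a : divFree) (f : SmoothFn), ⁅a, f⁆ = (a : Derivation ℝ SmoothFn SmoothFn) f :=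
    fun a f => rfl
  simp only [LieModule.Cohomology.d₂₃_apply, cochain_apply, areaForm_ham_right,
    LinearMap.zero_apply, hl, LieSubalgebra.coe_bracket, Derivation.commutator_apply,
    ham_coe_apply, map_neg] at e
  have hn : ∀ f g, poisson f (-g) = -poisson f g := fun f g => by
    rw [← neg_one_smul ℝ, poisson_smul_right, neg_one_smul]
  rw [poisson_antisymm h g, poisson_antisymm h f, poisson_antisymm g f] at e
  simp only [hn] at e
  rw [poisson_antisymm (poisson f g) h]
  linear_combination e

theorem ham_bracket (f g : SmoothFn) : ⁅ham f, ham g⁆ = ham (poisson f g) := by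
  apply divFree_ext
  intro i
  simp only [comp, LieSubalgebra.coe_bracket, Derivation.commutator_apply, ham_coe_apply,
    poisson_jacobi]

end Poisson

/-! ### Functions with vanishing gradient. -/

section Constants

theorem eq_zero_of_D_eq_zero {f : SmoothFn} (h : ∀ i, D i f = 0) (h0 : integ f = 0) : f = 0 := by
  have hb : ∀ v : E3, v = ∑ i, v i • ebasis i := fun v => by
    ext j; fin_cases j <;> simp [ebasis, Fin.sum_univ_three]
  have hd : ∀ y : E3, y ≠ 0 → fderiv ℝ (radialExt f) y = 0 := by
    intro y hy
    ext v
    rw [hb v, map_sum]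
    refine Finset.sum_eq_zero fun i _ => ?_
    have h1 := radialExt_D i f hy
    rw [h i] at h1
    have h2 : radialExt ⇑(0 : SmoothFn) y = 0 := by simp [radialExt]
    rw [h2, eq_comm, mul_eq_zero] at h1
    rw [map_smul, h1.resolve_left (norm_ne_zero_iff.2 hy), smul_zero]
  obtain ⟨c, hcst⟩ : ∃ c, ∀ y : E3, y ≠ 0 → radialExt f y = c := by
    have hconn : IsPreconnected ({0}ᶜ : Set E3) :=
      (isConnected_compl_singleton_of_one_lt_rank (by simp [← Module.finrank_eq_rank]) _).isPreconnected
    exact isOpen_compl_singleton.exists_is_const_of_fderiv_eq_zero hconn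
      (fun y hy => ((contDiffAt_radialExt f hy).differentiableAt (by simp)).differentiableWithinAt)
      (fun y hy => hd y hy)
  have hf : ∀ x : S2, f x = c := fun x => by
    rw [← radialExt_coe f x]; exact hcst _ (coe_ne_zero x)
  -- For a constant f = c one has ∫ f² = c ∫ f = 0, so the total area is not needed.
  apply eq_zero_of_integ_sq
  have : f * f = c • f := by
    ext x; simp [hf]
  rw [this, map_smul, h0, smul_zero]

/-- By Green's formula the hypothesis says that the Dirichlet integral vanishes. -/
theorem eq_zero_of_integ_mul_lap {f : SmoothFn} (h : integ (f * lap f) = 0) (h0 : integ f = 0) :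
    f = 0 := by
  refine eq_zero_of_D_eq_zero (fun i => ?_) h0
  rw [integ_mul_lap, neg_eq_zero, map_sum,
    Finset.sum_eq_zero_iff_of_nonneg
      (fun i _ => integ_nonneg fun x => mul_self_nonneg (D i f x))] at h
  exact eq_zero_of_integ_sq (h i (Finset.mem_univ i))

end Constants

/-! ### Closed 1-forms are exact; stream functions. -/

section Potential

/-- The open half space in direction `n`. -/
def halfSpace (n : E3) : Set E3 := {y | 0 < inner ℝ n y}

theorem isOpen_halfSpace (n : E3) : IsOpen (halfSpace n) :=
  isOpen_lt continuous_const (by fun_prop)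

theorem convex_halfSpace (n : E3) : Convex ℝ (halfSpace n) :=
  convex_halfSpace_gt (innerSL ℝ n).isLinear 0

theorem ne_zero_of_mem_halfSpace {n y : E3} (h : y ∈ halfSpace n) : y ≠ 0 := by
  rintro rfl
  simp [halfSpace] at h

/-- The complement of the closed ray opposite to the unit vector `e`. -/
def slit (e : E3) : Set E3 := {y | 0 < inner ℝ y e + ‖y‖}

theorem isOpen_slit (e : E3) : IsOpen (slit e) :=
  isOpen_lt continuous_const (by fun_prop)

theorem ne_zero_of_mem_slit {e y : E3} (h : y ∈ slit e) : y ≠ 0 := by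
  rintro rfl
  simp [slit] at h

/-- The slit space is covered by half spaces containing e. Each is convex and avoids the origin, so
the Poincaré lemma applies. Primitives normalised at e agree on intersections, which are again
convex and contain e. -/
theorem exists_primitive_slit {η : E3 → E3 →L[ℝ] ℝ} (hd : ∀ y ≠ 0, DifferentiableAt ℝ η y)
    (hs : ∀ y ≠ 0, ∀ a b, fderiv ℝ η y a b = fderiv ℝ η y b a) {e : E3} (he : ‖e‖ = 1) :
    ∃ F : E3 → ℝ, ∀ y ∈ slit e, HasFDerivAt F (η y) y := by
  have h1 : ∀ n : E3, ∃ f : E3 → ℝ, f e = 0 ∧ ∀ y ∈ halfSpace n, HasFDerivAt f (η y) y := by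
    intro n
    obtain ⟨f, hf⟩ := (convex_halfSpace n).exists_forall_hasFDerivAt_of_fderiv_symmetric
      (isOpen_halfSpace n)
      (fun y hy => (hd y (ne_zero_of_mem_halfSpace hy)).differentiableWithinAt)
      (fun y hy => hs y (ne_zero_of_mem_halfSpace hy))
    exact ⟨fun y => f y - f e, sub_self _, fun y hy => (hf y hy).sub_const _⟩
  choose f hfe hf using h1
  have hee : inner ℝ e e = (1 : ℝ) := by rw [real_inner_self_eq_norm_sq, he]; norm_num
  have heq : ∀ n n' : E3, e ∈ halfSpace n → e ∈ halfSpace n' →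
      ∀ y ∈ halfSpace n ∩ halfSpace n', f n y = f n' y := by
    intro n n' hn hn' y hy
    have hdiff : ∀ z ∈ halfSpace n ∩ halfSpace n',
        HasFDerivAt (fun w => f n w - f n' w) (0 : E3 →L[ℝ] ℝ) z := fun z hz => by
      simpa using! (hf n z hz.1).sub (hf n' z hz.2)
    have h := ((isOpen_halfSpace n).inter (isOpen_halfSpace n')).is_const_of_fderiv_eq_zero
      ((convex_halfSpace n).inter (convex_halfSpace n')).isPreconnected
      (fun z hz => (hdiff z hz).differentiableAt.differentiableWithinAt)
      (fun z hz => (hdiff z hz).fderiv) hy ⟨hn, hn'⟩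
    simp only [hfe, sub_self] at h
    exact sub_eq_zero.1 h
  -- The normal y + ‖y‖ e bisects the angle between y and e; its inner products with e and y are ⟨y,
  -- e⟩ + ‖y‖ and ‖y‖ times that.
  have hmem : ∀ y ∈ slit e, e ∈ halfSpace (y + ‖y‖ • e) ∧ y ∈ halfSpace (y + ‖y‖ • e) := by
    intro y hy
    have h0 : 0 < ‖y‖ := norm_pos_iff.2 (ne_zero_of_mem_slit hy)
    simp only [slit, Set.mem_ofPred_eq] at hy
    simp only [halfSpace, Set.mem_ofPred_eq, inner_add_left, real_inner_smul_left, hee,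
      real_inner_self_eq_norm_sq, real_inner_comm y e]
    constructor <;> nlinarith
  refine ⟨fun y => f (y + ‖y‖ • e) y, fun y hy => ?_⟩
  -- The half space defining the value varies with the point, but near y all these values agree with
  -- the primitive on the half space of y.
  refine (hf (y + ‖y‖ • e) y (hmem y hy).2).congr_of_eventuallyEq ?_
  filter_upwards [(isOpen_slit e).mem_nhds hy, (isOpen_halfSpace _).mem_nhds (hmem y hy).2]
    with z hz hz'
  exact heq _ _ (hmem z hz).1 (hmem y hy).1 z ⟨(hmem z hz).2, hz'⟩

/-- The two conditions together say |⟨y, e⟩| < ‖y‖, the strict Cauchy–Schwarz inequality, which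
fails exactly on the line through e. -/
theorem slit_inter_slit_neg {e : E3} (he : ‖e‖ = 1) :
    slit e ∩ slit (-e) = (Submodule.span ℝ {e} : Set E3)ᶜ := by
  ext y
  have hee : inner ℝ e e = (1 : ℝ) := by rw [real_inner_self_eq_norm_sq, he]; norm_num
  simp only [slit, Set.mem_inter_iff, Set.mem_ofPred_eq, Set.mem_compl_iff, SetLike.mem_coe,
    Submodule.mem_span_singleton, inner_neg_right, not_exists]
  constructor
  · rintro ⟨h1, h2⟩ c rfl
    rw [real_inner_smul_left, hee, norm_smul, he, Real.norm_eq_abs] at h1 h2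
    rcases abs_choice c with h | h <;> rw [h] at h1 h2 <;> linarith
  · intro h
    have h1 : 0 < ‖y - (inner ℝ y e : ℝ) • e‖ ^ 2 := by
      have : y - (inner ℝ y e : ℝ) • e ≠ 0 := fun h0 => h (inner ℝ y e) (sub_eq_zero.1 h0).symm
      positivity
    rw [← real_inner_self_eq_norm_sq] at h1
    simp only [inner_sub_left, inner_sub_right, real_inner_smul_left, real_inner_smul_right,
      real_inner_self_eq_norm_sq, real_inner_comm y e, norm_smul, he, mul_one, Real.norm_eq_abs,
      sq_abs] at h1
    have h2 : |(inner ℝ y e : ℝ)| < ‖y‖ := abs_lt_of_sq_lt_sq (by linarith) (norm_nonneg y)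
    rw [abs_lt] at h2
    constructor <;> linarith

/-- A closed 1-form on `ℝ³ ∖ {0}` is exact. -/
theorem exists_primitive {η : E3 → E3 →L[ℝ] ℝ} (hd : ∀ y ≠ 0, DifferentiableAt ℝ η y)
    (hs : ∀ y ≠ 0, ∀ a b, fderiv ℝ η y a b = fderiv ℝ η y b a) :
    ∃ F : E3 → ℝ, ∀ y ≠ 0, HasFDerivAt F (η y) y := by
  have he : ‖ebasis 0‖ = 1 := by simp [ebasis]
  obtain ⟨F, hF⟩ := exists_primitive_slit hd hs he
  obtain ⟨G, hG⟩ := exists_primitive_slit hd hs (e := -ebasis 0) (by rwa [norm_neg])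
  -- The overlap is the complement of a line, of codimension 2 and hence connected; so the two
  -- primitives differ there by a single constant and can be glued.
  have hconn : IsPreconnected (slit (ebasis 0) ∩ slit (-ebasis 0)) := by
    rw [slit_inter_slit_neg he]
    refine (isConnected_compl_of_one_lt_codim ?_).isPreconnected
    rw [← Module.finrank_eq_rank]
    have h1 := Submodule.finrank_quotient_add_finrank (Submodule.span ℝ {ebasis 0})
    have h2 : ebasis 0 ≠ 0 := fun h => by simp [h] at he
    rw [finrank_span_singleton h2, finrank_euclideanSpace_fin] at h1
    have h3 : Module.finrank ℝ (E3 ⧸ Submodule.span ℝ {ebasis 0}) = 2 := by omega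
    rw [h3]
    norm_num
  have hdiff : ∀ z ∈ slit (ebasis 0) ∩ slit (-ebasis 0),
      HasFDerivAt (fun w => F w - G w) (0 : E3 →L[ℝ] ℝ) z := fun z hz => by
    simpa using! (hF z hz.1).sub (hG z hz.2)
  obtain ⟨c, hc⟩ := ((isOpen_slit _).inter (isOpen_slit _)).exists_is_const_of_fderiv_eq_zero hconn
      (fun z hz => (hdiff z hz).differentiableAt.differentiableWithinAt)
      (fun z hz => (hdiff z hz).fderiv)
  classical
  refine ⟨fun y => if y ∈ slit (ebasis 0) then F y else G y + c, fun y hy => ?_⟩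
  by_cases h : y ∈ slit (ebasis 0)
  · refine (hF y h).congr_of_eventuallyEq ?_
    filter_upwards [(isOpen_slit _).mem_nhds h] with z hz
    simp [hz]
  · have h' : y ∈ slit (-ebasis 0) := by
      have h0 := norm_pos_iff.2 hy
      simp only [slit, Set.mem_ofPred_eq, inner_neg_right] at h ⊢
      linarith
    refine ((hG y h').add_const c).congr_of_eventuallyEq ?_
    filter_upwards [(isOpen_slit _).mem_nhds h'] with z hz
    split_ifs with hz'
    · rw [← hc z ⟨hz', hz⟩]; ring
    · rfl

theorem radialExt_eq (f : S2 → ℝ) {y : E3} (hy : y ≠ 0) :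
    radialExt f y = f ⟨‖y‖⁻¹ • y, by simp [norm_smul, hy]⟩ := by
  simp [radialExt, hy]

theorem hasFDerivAt_norm_of_ne_zero {y : E3} (hy : y ≠ 0) :
    HasFDerivAt (fun z : E3 => ‖z‖) (‖y‖⁻¹ • innerSL ℝ y) y := by
  have h := (hasStrictFDerivAt_norm_sq y).hasFDerivAt.sqrt (by simpa using hy)
  simp only [norm_nonneg, Real.sqrt_sq] at h
  convert! h using 1
  ext z
  simp
  field_simp

/-- A closed tangential 1-form on `S²` is exact. -/
theorem exists_potential {θ : Fin 3 → SmoothFn} (ht : ∑ i, coord i * θ i = 0)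
    (hc : ∀ i j, D j (θ i) - D i (θ j) = coord j * θ i - coord i * θ j) :
    ∃ φ : SmoothFn, ∀ i, D i φ = θ i := by
  have hgC : ∀ i, ∀ y ≠ 0, ContDiffAt ℝ ∞ (fun y : E3 => ‖y‖⁻¹ * radialExt (θ i) y) y :=
    fun i y hy => ((contDiffAt_norm ℝ hy).inv (norm_ne_zero_iff.2 hy)).mul
      (contDiffAt_radialExt (θ i) hy)
  -- For tangential θ the form Σ gᵢ dyᵢ is the pullback of θ under y ↦ y/|y|, which accounts for the
  -- factor ‖y‖⁻¹.
  set g : Fin 3 → E3 → ℝ := fun i y => ‖y‖⁻¹ * radialExt (θ i) y with hg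
  set η : E3 → E3 →L[ℝ] ℝ := fun y => ∑ i, g i y • (EuclideanSpace.proj i : E3 →L[ℝ] ℝ) with hη
  have hηC : ∀ y ≠ 0, ContDiffAt ℝ ∞ η y := fun y hy =>
    ContDiffAt.sum fun i _ => (hgC i y hy).smul contDiffAt_const
  have hgd : ∀ i, ∀ y ≠ 0, DifferentiableAt ℝ (g i) y := fun i y hy =>
    (hgC i y hy).differentiableAt (by simp)
  -- The subtracted term comes from differentiating ‖y‖⁻¹; with it, symmetry of the Jacobian is
  -- precisely the hypothesis `hc`.
  have hpart : ∀ i j, ∀ y ≠ 0, fderiv ℝ (g i) y (ebasis j)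
      = ‖y‖⁻¹ ^ 2 * (radialExt ⇑(D j (θ i)) y - radialExt ⇑(coord j * θ i) y) := by
    intro i j y hy
    have hn := norm_ne_zero_iff.2 hy
    have h1 : HasFDerivAt (fun z : E3 => ‖z‖⁻¹) (-(‖y‖ ^ 2)⁻¹ • (‖y‖⁻¹ • innerSL ℝ y)) y :=
      (hasDerivAt_inv hn).comp_hasFDerivAt y (hasFDerivAt_norm_of_ne_zero hy)
    have h2 := (h1.mul ((contDiffAt_radialExt (θ i) hy).differentiableAt
      (by simp)).hasFDerivAt).fderiv
    have h3 : radialExt ⇑(coord j * θ i) y = ‖y‖⁻¹ * y j * radialExt (θ i) y := by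
      simp [radialExt, hy, coord]
    rw [radialExt_D j _ hy, h3]
    refine (congrArg (fun T : E3 →L[ℝ] ℝ => T (ebasis j)) h2).trans ?_
    simp [ebasis, EuclideanSpace.inner_single_right]
    field_simp
    ring
  have hsymm : ∀ i j, ∀ y ≠ 0, fderiv ℝ (g i) y (ebasis j) = fderiv ℝ (g j) y (ebasis i) := by
    intro i j y hy
    rw [hpart i j y hy, hpart j i y hy]
    congr 1
    have h := congrArg (fun f : SmoothFn => radialExt f y) (hc i j)
    simp only [radialExt_eq _ hy] at h ⊢
    simp only [ContMDiffMap.coe_sub, Pi.sub_apply] at h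
    linarith
  have hb : ∀ v : E3, v = ∑ i, v i • ebasis i := fun v => by
    ext j; fin_cases j <;> simp [ebasis, Fin.sum_univ_three]
  have hηd : ∀ y ≠ 0, ∀ a b : E3, fderiv ℝ η y a b
      = ∑ i, ∑ j, a j * b i * fderiv ℝ (g i) y (ebasis j) := by
    intro y hy a b
    have h1 : HasFDerivAt η (∑ i, (fderiv ℝ (g i) y).smulRight
        (EuclideanSpace.proj i : E3 →L[ℝ] ℝ)) y :=
      by
      refine HasFDerivAt.fun_sum fun i _ => ?_
      exact (hgd i y hy).hasFDerivAt.smul_const (EuclideanSpace.proj i : E3 →L[ℝ] ℝ)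
    rw [h1.fderiv]
    simp only [sum_apply, ContinuousLinearMap.smulRight_apply,
      smul_apply, smul_eq_mul, PiLp.proj_apply]
    refine Finset.sum_congr rfl fun i _ => ?_
    conv_lhs => rw [hb a, map_sum]
    simp only [map_smul, smul_eq_mul, Finset.sum_mul]
    refine Finset.sum_congr rfl fun j _ => by ring
  obtain ⟨F, hF⟩ := exists_primitive (η := η)
    (fun y hy => (hηC y hy).differentiableAt (by simp)) (by
      intro y hy a b
      rw [hηd y hy, hηd y hy, Finset.sum_comm]
      refine Finset.sum_congr rfl fun i _ => Finset.sum_congr rfl fun j _ => ?_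
      rw [hsymm j i y hy]
      ring)
  have hFC : ContDiffOn ℝ ∞ F {0}ᶜ := by
    rw [contDiffOn_infty_iff_fderiv_of_isOpen isOpen_compl_singleton]
    refine ⟨fun y hy => (hF y hy).differentiableAt.differentiableWithinAt, ?_⟩
    refine ContDiffOn.congr (f := η) (fun y hy => (hηC y hy).contDiffWithinAt) ?_
    exact fun y hy => (hF y hy).fderiv
  refine ⟨ofAmbient F fun x => hFC.contDiffAt (isOpen_compl_singleton.mem_nhds (coe_ne_zero x)),
    fun i => ?_⟩
  ext x
  have hx := norm_eq_of_mem_sphere x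
  have h1 : HasFDerivAt (fun y : E3 => ‖y‖⁻¹) (-(innerSL ℝ (x : E3))) (x : E3) := by
    have := (hasDerivAt_inv (by simp [hx] : ‖(x:E3)‖ ≠ 0)).comp_hasFDerivAt (x:E3)
      (fderiv_norm_apply x)
    simpa [hx] using! this
  have h2 : HasFDerivAt (fun y : E3 => ‖y‖⁻¹ • y) (‖(x : E3)‖⁻¹ • ContinuousLinearMap.id ℝ E3
      + (-(innerSL ℝ (x : E3))).smulRight (id (x : E3))) (x : E3) :=
    h1.smul (hasFDerivAt_id (x : E3))
  have h3 : HasFDerivAt F (η x) (‖(x : E3)‖⁻¹ • (x : E3)) := by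
    simpa [hx] using hF x (coe_ne_zero x)
  have h4 := HasFDerivAt.comp (f := fun y : E3 => ‖y‖⁻¹ • y) (x : E3) h3 h2
  have h5 := h4.congr_of_eventuallyEq (f₁ := radialExt (ofAmbient F fun x =>
      hFC.contDiffAt (isOpen_compl_singleton.mem_nhds (coe_ne_zero x)))) (by
    filter_upwards [isOpen_ne.mem_nhds (coe_ne_zero x)] with y hy
    rw [radialExt_ofAmbient _ _ hy]
    rfl)
  rw [D_apply, h5.fderiv]
  have htx := congrArg (fun f : SmoothFn => f x) ht
  have hgx : ∀ j, g j x = θ j x := fun j => by simp [hg, hx, radialExt_coe]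
  simp only [ContinuousLinearMap.comp_apply]
  have h6 : ((‖(x : E3)‖⁻¹ • ContinuousLinearMap.id ℝ E3
      + (-(innerSL ℝ (x : E3))).smulRight (id (x : E3))) (ebasis i))
      = ebasis i - (x : E3) i • (x : E3) := by
    simp [hx, ebasis, EuclideanSpace.inner_single_right, sub_eq_add_neg]
  -- The derivative of y/|y| at x sends eᵢ to eᵢ − xᵢ x. Tangency of θ kills the radial part, so
  -- radial constancy of F is not needed.
  have h7 : η x (x : E3) = 0 := by
    simp only [hη, sum_apply, smul_apply, hgx,
      PiLp.proj_apply, smul_eq_mul]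
    simpa [Fin.sum_univ_three, coord, mul_comm] using htx
  have h8 : η x (ebasis i) = θ i x := by
    simp [hη, hgx, ebasis]
  refine (congrArg (η x) h6).trans ?_
  rw [map_sub, map_smul, h7, h8, smul_zero, sub_zero]

/-- Integrating ∫ v(f) = 0 by parts against every f turns the weak condition into the pointwise one;
the curvature term drops out because v is tangent. -/
theorem divergence_eq_zero (v : divFree) : ∑ i, D i (comp v i) = 0 := by
  refine eq_of_forall_integ_mul fun f => ?_
  have h := v.2.2 f
  have ht := sum_coord_comp v
  rw [v.2.1 f, map_sum] at h
  simp only [integ_mul_D] at h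
  rw [← map_sum] at h
  rw [mul_zero, map_zero, ← neg_eq_zero, ← map_neg, ← h]
  congr 1
  simp only [Fin.sum_univ_three] at ht ⊢
  linear_combination -2 * f * ht

/-- Every divergence-free vector field on `S²` has a stream function. -/
theorem exists_ham (v : divFree) : ∃ φ, v = ham φ := by
  have hx := sum_coord_sq
  have hv := sum_coord_comp v
  have hd := divergence_eq_zero v
  have h0 := sum_coord_mul_D (comp v 0)
  have h1 := sum_coord_mul_D (comp v 1)
  have h2 := sum_coord_mul_D (comp v 2)
  simp only [Fin.sum_univ_three] at hx hv hd h0 h1 h2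
  -- Since v = x × (v × x) for tangent v, the gradient of φ must be v × x. This form is closed
  -- because v has zero divergence.
  obtain ⟨φ, hφ⟩ := exists_potential (θ := crossProduct (comp v) coord) (by
      simp only [Fin.sum_univ_three, crossProduct, LinearMap.mk₂_apply,
        Matrix.cons_val_zero, Matrix.cons_val_one, Matrix.cons_val]
      ring) (by
      have h01 : D 1 (comp v 1 * coord 2 - comp v 2 * coord 1)
          - D 0 (comp v 2 * coord 0 - comp v 0 * coord 2)
          = coord 1 * (comp v 1 * coord 2 - comp v 2 * coord 1)
          - coord 0 * (comp v 2 * coord 0 - comp v 0 * coord 2) := by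
        simp only [map_sub, Derivation.leibniz, smul_eq_mul, D_coord, if_true]
        simp
        linear_combination coord 2 * hd - h2 - 2 * coord 2 * hv + 2 * comp v 2 * hx
      have h12 : D 2 (comp v 2 * coord 0 - comp v 0 * coord 2)
          - D 1 (comp v 0 * coord 1 - comp v 1 * coord 0)
          = coord 2 * (comp v 2 * coord 0 - comp v 0 * coord 2)
          - coord 1 * (comp v 0 * coord 1 - comp v 1 * coord 0) := by
        simp only [map_sub, Derivation.leibniz, smul_eq_mul, D_coord, if_true]
        simp
        linear_combination coord 0 * hd - h0 - 2 * coord 0 * hv + 2 * comp v 0 * hx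
      have h20 : D 0 (comp v 0 * coord 1 - comp v 1 * coord 0)
          - D 2 (comp v 1 * coord 2 - comp v 2 * coord 1)
          = coord 0 * (comp v 0 * coord 1 - comp v 1 * coord 0)
          - coord 2 * (comp v 1 * coord 2 - comp v 2 * coord 1) := by
        simp only [map_sub, Derivation.leibniz, smul_eq_mul, D_coord, if_true]
        simp
        linear_combination coord 1 * hd - h1 - 2 * coord 1 * hv + 2 * comp v 1 * hx
      intro i j
      simp only [crossProduct, LinearMap.mk₂_apply]
      fin_cases i <;> fin_cases j <;>
        simp only [Fin.zero_eta, Fin.mk_one, Fin.reduceFinMk, Matrix.cons_val_zero,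
          Matrix.cons_val_one, Matrix.cons_val, sub_self]
      · linear_combination h01
      · linear_combination -h20
      · linear_combination -h01
      · linear_combination h12
      · linear_combination h20
      · linear_combination -h12)
  refine ⟨φ, divFree_ext fun i => ?_⟩
  have hg : grad φ = crossProduct (comp v) coord := funext hφ
  simp only [ham, comp_hamDer, hg, crossProduct, LinearMap.mk₂_apply]
  fin_cases i <;>
    simp only [Fin.zero_eta, Fin.mk_one, Fin.reduceFinMk, Matrix.cons_val_zero,
      Matrix.cons_val_one, Matrix.cons_val]
  · linear_combination -comp v 0 * hx + coord 0 * hv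
  · linear_combination -comp v 1 * hx + coord 1 * hv
  · linear_combination -comp v 2 * hx + coord 2 * hv

end Potential

/-! ### Time-dependent functions and weak formulations. -/

section Time

/-- The radially constant extension `(t, y) ↦ u(t, y / |y|)` of a time-dependent function. -/
noncomputable def timeExt (u : ℝ → SmoothFn) (p : ℝ × E3) : ℝ := radialExt (u p.1) p.2

/-- Joint smoothness of the radially constant extension on `J × (ℝ³ ∖ {0})`. -/
def SmoothAmbient (J : Set ℝ) (u : ℝ → SmoothFn) : Prop :=
  ∀ t ∈ J, ∀ y : E3, y ≠ 0 → ContDiffAt ℝ ∞ (timeExt u) (t, y)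

theorem SmoothInTime.smoothAmbient {J : Set ℝ} (hJ : IsOpen J) {u : ℝ → SmoothFn}
    (hu : SmoothInTime J u) : SmoothAmbient J u := by
  intro t ht y hy
  have : Fact (Module.finrank ℝ E3 = 2 + 1) := ⟨by simp⟩
  let U : TopologicalSpace.Opens (ℝ × E3) :=
    ⟨{p | p.2 ≠ 0}, isOpen_ne.preimage continuous_snd⟩
  have hN : ContMDiff 𝓘(ℝ, ℝ × E3) 𝓘(ℝ, E3) ∞
      (fun z : U => ‖(z : ℝ × E3).2‖⁻¹ • (z : ℝ × E3).2) := by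
    intro z
    have hz : (z : ℝ × E3).2 ≠ 0 := z.2
    refine (contMDiffAt_subtype_iff (f := fun z : ℝ × E3 => ‖z.2‖⁻¹ • z.2)).2 ?_
    refine ContDiffAt.contMDiffAt ?_
    exact ((contDiffAt_snd.norm ℝ hz).inv (norm_ne_zero_iff.2 hz)).smul contDiffAt_snd
  have hT : ContMDiff 𝓘(ℝ, ℝ × E3) 𝓘(ℝ, ℝ) ∞ (fun z : U => (z : ℝ × E3).1) := fun z =>
    (contMDiffAt_subtype_iff (f := fun z : ℝ × E3 => z.1)).2 contDiffAt_fst.contMDiffAt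
  have hmem : ∀ z : U, ‖(z : ℝ × E3).2‖⁻¹ • (z : ℝ × E3).2 ∈ Metric.sphere (0 : E3) 1 := by
    intro z
    have hz : (z : ℝ × E3).2 ≠ 0 := z.2
    simp [norm_smul, hz]
  have hP := hT.prodMk (ContMDiff.codRestrict_sphere (n := 2) hN hmem)
  have huAt := hu.contMDiffAt (x := (t, Set.codRestrict _ _ hmem ⟨(t, y), hy⟩))
    ((hJ.prod isOpen_univ).mem_nhds ⟨ht, trivial⟩)
  have hc := huAt.comp (⟨(t, y), hy⟩ : U) hP.contMDiffAt
  have h2 : ContMDiffAt 𝓘(ℝ, ℝ × E3) 𝓘(ℝ, ℝ) ∞ (fun z : U => timeExt u z) ⟨(t, y), hy⟩ := by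
    convert! hc using 1
    funext z
    have hz : (z : ℝ × E3).2 ≠ 0 := z.2
    simp [timeExt, radialExt, hz, Set.codRestrict]
  exact (contMDiffAt_subtype_iff.1 h2).contDiffAt

namespace SmoothAmbient

variable {J : Set ℝ} {u : ℝ → SmoothFn}

/-- The extension of the tangential derivative is a partial derivative of `timeExt u` in the
direction (0, eᵢ), multiplied by ‖y‖ to restore homogeneity of degree zero. -/
theorem D (hJ : IsOpen J) (hu : SmoothAmbient J u) (i : Fin 3) :
    SmoothAmbient J (fun t => AxiMHD.D i (u t)) := by
  intro t ht y hy
  have h1 : ContDiffAt ℝ ∞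
      (fun p : ℝ × E3 => ‖p.2‖ * fderiv ℝ (timeExt u) p (0, ebasis i)) (t, y) :=
    (contDiffAt_snd.norm ℝ hy).mul
      (((hu t ht y hy).fderiv_right (m := ∞) (by simp)).clm_apply contDiffAt_const)
  refine h1.congr_of_eventuallyEq ?_
  filter_upwards [(hJ.prod isOpen_ne).mem_nhds (show (t, y) ∈ J ×ˢ {z : E3 | z ≠ 0} from ⟨ht, hy⟩)]
    with p hp
  have h2 : HasFDerivAt (radialExt (u p.1))
      ((fderiv ℝ (timeExt u) p).comp (ContinuousLinearMap.inr ℝ ℝ E3)) p.2 :=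
    HasFDerivAt.comp (g := timeExt u) (f := fun z : E3 => (p.1, z)) p.2
      ((hu p.1 hp.1 p.2 hp.2).differentiableAt (by simp)).hasFDerivAt
      (hasFDerivAt_prodMk_right p.1 p.2)
  rw [timeExt, radialExt_D i _ hp.2, h2.fderiv]
  rfl

theorem add (hu : SmoothAmbient J u) {v : ℝ → SmoothFn} (hv : SmoothAmbient J v) :
    SmoothAmbient J (fun t => u t + v t) := by
  intro t ht y hy
  refine ((hu t ht y hy).add (hv t ht y hy)).congr_of_eventuallyEq (.of_forall fun p => ?_)
  exact congrFun (radialExt_add (u p.1) (v p.1)) p.2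

theorem const_smul (hu : SmoothAmbient J u) (c : ℝ) : SmoothAmbient J (fun t => c • u t) := by
  intro t ht y hy
  refine (contDiffAt_const (c := c).smul (hu t ht y hy)).congr_of_eventuallyEq
    (.of_forall fun p => ?_)
  exact congrFun (radialExt_const_smul c (u p.1)) p.2

theorem lap (hJ : IsOpen J) (hu : SmoothAmbient J u) :
    SmoothAmbient J (fun t => AxiMHD.lap (u t)) := by
  simp only [AxiMHD.lap, Fin.sum_univ_three]
  have h := fun i => (hu.D hJ i).D hJ i
  exact ((h 0).add (h 1)).add (h 2)

theorem hasDerivAt_apply (hu : SmoothAmbient J u) {t : ℝ} (ht : t ∈ J) (x : S2) :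
    HasDerivAt (fun s => u s x) (fderiv ℝ (timeExt u) (t, x) (1, 0)) t := by
  have h := HasFDerivAt.comp_hasDerivAt (l := timeExt u) (f := fun s : ℝ => (s, (x : E3))) t
    ((hu t ht x (coe_ne_zero x)).differentiableAt (by simp)).hasFDerivAt
    ((hasDerivAt_id t).prodMk (hasDerivAt_const t (x : E3)))
  exact h.congr_of_eventuallyEq (.of_forall fun s => (radialExt_coe (u s) x).symm)

/-- The time derivative of a smooth time-dependent function, with differentiation under the
integral sign. -/
theorem exists_hasDerivAt (hJ : IsOpen J) (hu : SmoothAmbient J u) {t : ℝ} (ht : t ∈ J) :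
    ∃ u' : SmoothFn, (∀ x, HasDerivAt (fun s => u s x) (u' x) t) ∧
      ∀ g : SmoothFn, HasDerivAt (fun s => integ (g * u s)) (integ (g * u')) t := by
  have hcd : ∀ s ∈ J, ∀ y : E3, y ≠ 0 →
      ContDiffAt ℝ ∞ (fun p => fderiv ℝ (timeExt u) p (1, 0)) (s, y) := fun s hs y hy =>
    ((hu s hs y hy).fderiv_right (m := ∞) (by simp)).clm_apply contDiffAt_const
  refine ⟨ofAmbient (fun y => fderiv ℝ (timeExt u) (t, y) (1, 0)) fun x =>
    ContDiffAt.comp (g := fun p => fderiv ℝ (timeExt u) p (1, 0)) (x : E3)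
      (hcd t ht x (coe_ne_zero x)) (contDiffAt_const.prodMk contDiffAt_id),
    fun x => hu.hasDerivAt_apply ht x, fun g => ?_⟩
  obtain ⟨ε, hε, hεJ⟩ := Metric.nhds_basis_closedBall.mem_iff.1 (hJ.mem_nhds ht)
  have hcont : ContinuousOn (fun p : ℝ × S2 => g p.2 * fderiv ℝ (timeExt u) (p.1, (p.2 : E3)) (1, 0))
      (Metric.closedBall t ε ×ˢ Set.univ) := by
    refine (g.contMDiff.continuous.comp continuous_snd).continuousOn.mul fun p hp => ?_
    refine ContinuousAt.continuousWithinAt ?_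
    exact ContinuousAt.comp (g := fun p => fderiv ℝ (timeExt u) p (1, 0))
      (f := fun p : ℝ × S2 => (p.1, (p.2 : E3)))
      (hcd p.1 (hεJ hp.1) p.2 (coe_ne_zero p.2)).continuousAt (by fun_prop)
  -- Compactness of a closed time interval times the sphere gives a constant dominating function.
  obtain ⟨C, hC⟩ := ((isCompact_closedBall t ε).prod isCompact_univ).exists_bound_of_continuousOn
    hcont
  refine (hasDerivAt_integral_of_dominated_loc_of_deriv_le (μ := area) (x₀ := t)
    (F := fun s x => (g * u s) x)
    (F' := fun s x => g x * fderiv ℝ (timeExt u) (s, (x : E3)) (1, 0))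
    (bound := fun _ => C) (Metric.ball_mem_nhds t hε)
    (.of_forall fun s => (integrable_area (g * u s)).aestronglyMeasurable)
    (integrable_area (g * u t)) ?_ ?_ (integrable_const C) ?_).2
  · exact ((hcont.comp_continuous (f := fun x : S2 => (t, x)) (by fun_prop)
      fun x => ⟨Metric.mem_closedBall_self hε.le, trivial⟩).aestronglyMeasurable)
  · exact .of_forall fun x s hs => hC (s, x) ⟨Metric.ball_subset_closedBall hs, trivial⟩
  · exact .of_forall fun x s hs =>
      (hu.hasDerivAt_apply (hεJ (Metric.ball_subset_closedBall hs)) x).const_mul (g x)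

/-- A smooth time-dependent function satisfies an evolution equation pointwise if and only if it
does so weakly. -/
theorem forall_hasDerivAt_iff (hJ : IsOpen J) (hu : SmoothAmbient J u) {t : ℝ} (ht : t ∈ J)
    (f : SmoothFn) : (∀ x, HasDerivAt (fun s => u s x) (f x) t) ↔
      ∀ g : SmoothFn, HasDerivAt (fun s => integ (g * u s)) (integ (g * f)) t := by
  obtain ⟨u', h1, h2⟩ := hu.exists_hasDerivAt hJ ht
  constructor
  · intro h
    have : u' = f := by ext x; exact (h1 x).unique (h x)
    exact this ▸ h2
  · intro h
    have : u' = f := eq_of_forall_integ_mul fun g => (h2 g).unique (h g)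
    exact this ▸ h1

end SmoothAmbient

end Time

/-! ### Pairings written as integrals of scalar functions. -/

section Weak

/-- Crossing with the unit normal is an isometry of the tangent plane. -/
theorem sum_comp_ham (ψ φ : SmoothFn) :
    ∑ i, comp (ham ψ) i * comp (ham φ) i = ∑ i, D i ψ * D i φ := by
  have hx := sum_coord_sq
  have hψ := sum_coord_mul_D ψ
  simp only [Fin.sum_univ_three] at hx hψ ⊢
  simp only [ham, comp_hamDer, crossProduct, LinearMap.mk₂_apply, grad,
    Matrix.cons_val_zero, Matrix.cons_val_one, Matrix.cons_val]
  linear_combination (D 0 ψ * D 0 φ + D 1 ψ * D 1 φ + D 2 ψ * D 2 φ) * hx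
    - (coord 0 * D 0 φ + coord 1 * D 1 φ + coord 2 * D 2 φ) * hψ

theorem inertia_ham (κ : ℝ) (ψ q φ τ : SmoothFn) :
    inertia κ (AbelianExt.mk (ham ψ) q) (AbelianExt.mk (ham φ) τ)
      = κ * integ (q * τ) - integ (φ * lap ψ) := by
  simp only [inertia, LinearMap.mk₂_apply, AbelianExt.fn_mk, AbelianExt.vf_mk, sum_comp_ham,
    integ_mul_lap, map_add, map_smul, smul_eq_mul]
  ring

/-- The triple product turns a · (x × ∇ξ) into (a × x) · ∇ξ, and integrating by parts frees ξ. The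
resulting c is minus the divergence of the tangent field a × x. -/
theorem smoothDual_ham (l : smoothDual) : ∃ r c : SmoothFn, ∀ ξ ρ : SmoothFn,
    (l : Module.Dual ℝ AbelianExt) (AbelianExt.mk (ham ξ) ρ) = integ (r * ρ) + integ (c * ξ) := by
  obtain ⟨l, r, a, h⟩ := l
  refine ⟨r, ∑ i, (2 * coord i * crossProduct a coord i - D i (crossProduct a coord i)),
    fun ξ ρ => ?_⟩
  refine (h _).trans ?_
  rw [map_add, AbelianExt.fn_mk, AbelianExt.vf_mk]
  congr 1
  have e : ∑ i, a i * comp (ham ξ) i = ∑ i, crossProduct a coord i * D i ξ := by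
    simp only [ham, comp_hamDer, crossProduct, LinearMap.mk₂_apply, grad, Fin.sum_univ_three,
      Matrix.cons_val_zero, Matrix.cons_val_one, Matrix.cons_val]
    ring
  rw [e, mul_comm, Finset.mul_sum, map_sum, map_sum]
  exact Finset.sum_congr rfl fun i _ => integ_mul_D i _ _

theorem lie_ham (ψ σ φ τ : SmoothFn) :
    ⁅AbelianExt.mk (ham ψ) σ, AbelianExt.mk (ham φ) τ⁆
      = AbelianExt.mk (ham (poisson ψ φ)) (poisson ψ τ - poisson φ σ - poisson ψ φ) := by
  rw [AbelianExt.lie_eq]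
  simp only [AbelianExt.vf_mk, AbelianExt.fn_mk, ham_bracket, ham_lie, areaForm_ham]

/-- The signs come from the action on the smooth dual being −ad*. -/
theorem pairing_lie (m : MagneticDual) (x y : MagneticExt) :
    pairing m ⁅x, y⁆ = (m.2 : Module.Dual ℝ AbelianExt) ⁅x.fst, y.fst⁆
      - (y.snd : Module.Dual ℝ AbelianExt) ⁅x.fst, m.1⁆
      + (x.snd : Module.Dual ℝ AbelianExt) ⁅y.fst, m.1⁆ := by
  rw [MagneticExt.lie_eq]
  have h : ∀ (v : AbelianExt) (l : smoothDual),
      ((⁅v, l⁆ : smoothDual) : Module.Dual ℝ AbelianExt) m.1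
        = -(l : Module.Dual ℝ AbelianExt) ⁅v, m.1⁆ := fun v l => by
    rw [LieSubmodule.coe_bracket, Module.Dual.lie_apply]
  have hsub : ∀ k l : smoothDual, ((k - l : smoothDual) : Module.Dual ℝ AbelianExt) m.1
      = (k : Module.Dual ℝ AbelianExt) m.1 - (l : Module.Dual ℝ AbelianExt) m.1 := fun _ _ => rfl
  have e' : pairing m (MagneticExt.mk ⁅x.fst, y.fst⁆ (⁅x.fst, y.snd⁆ - ⁅y.fst, x.snd⁆))
    = (m.2 : Module.Dual ℝ AbelianExt) ⁅x.fst, y.fst⁆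
    + ((⁅x.fst, y.snd⁆ - ⁅y.fst, x.snd⁆ : smoothDual) : Module.Dual ℝ AbelianExt) m.1 := rfl
  refine e'.trans ?_
  refine (congrArg (fun z : ℝ => (m.2 : Module.Dual ℝ AbelianExt) ⁅x.fst, y.fst⁆ + z)
    ((hsub _ _).trans (congrArg₂ (fun a b : ℝ => a - b) (h _ _) (h _ _)))).trans ?_
  have hABC : ∀ A B C : ℝ, A + (-B - -C) = A - B + C := fun A B C => by ring
  exact hABC _ _ _

variable {κ : ℝ} {ψ ρ q ξ : SmoothFn} {y : MagneticExt} {φ τ r c : SmoothFn}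

theorem pairing_ham (h1 : y.fst = AbelianExt.mk (ham φ) τ)
    (h2 : ∀ ξ ρ : SmoothFn, (y.snd : Module.Dual ℝ AbelianExt) (AbelianExt.mk (ham ξ) ρ)
      = integ (r * ρ) + integ (c * ξ)) :
    pairing (AbelianExt.mk (ham ξ) ρ, inertiaOp κ (AbelianExt.mk (ham ψ) q)) y
      = κ * integ (τ * q) - integ (φ * lap ψ) + integ (r * ρ) + integ (c * ξ) := by
  simp only [pairing, h1, h2, inertiaOp, inertia_ham, mul_comm q τ]
  ring

/-- Each integral pairs a test function with the right-hand side of one equation. The cocycle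
contributes κ{q, ψ} and κ{ξ, γ} to the first equation and {ψ, ξ} to the second; these produce the
terms with coefficient 2 in the MHD system. -/
theorem pairing_lie_ham (h1 : y.fst = AbelianExt.mk (ham φ) τ)
    (h2 : ∀ ξ ρ : SmoothFn, (y.snd : Module.Dual ℝ AbelianExt) (AbelianExt.mk (ham ξ) ρ)
      = integ (r * ρ) + integ (c * ξ)) (α γ : SmoothFn) :
    pairing (AbelianExt.mk (ham ξ) ρ, inertiaOp κ (AbelianExt.mk (ham ψ) q))
        ⁅MagneticExt.mk (AbelianExt.mk (ham ψ) α) (inertiaOp κ (AbelianExt.mk (ham ξ) γ)), y⁆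
      = κ * integ (τ * (poisson q ψ + poisson ξ γ))
        - integ (φ * (poisson (lap ψ) ψ + poisson ξ (lap ξ)
          + κ • (poisson α q + poisson q ψ + poisson γ ρ + poisson ξ γ)))
        + integ (r * (poisson ρ ψ + poisson ξ α + poisson ψ ξ))
        + integ (c * poisson ξ ψ) := by
  rw [pairing_lie, h1]
  change inertia κ _ ⁅AbelianExt.mk (ham ψ) α, _⁆ - (y.snd : Module.Dual ℝ AbelianExt)
    ⁅AbelianExt.mk (ham ψ) α, _⁆ + inertia κ (AbelianExt.mk (ham ξ) γ) ⁅_, _⁆ = _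
  simp only [lie_ham, h2, inertia_ham]
  have hn : ∀ f g h, integ (f * poisson g h) = -integ (f * poisson h g) := fun f g h => by
    rw [poisson_antisymm, mul_neg, map_neg]
  simp only [mul_add, mul_sub, mul_smul_comm, map_add, map_sub, map_smul, smul_eq_mul]
  -- Cyclic rotations and sign changes bring the two sides to common representatives of each
  -- integral of a triple.
  rw [integ_mul_poisson τ q ψ, integ_mul_poisson q φ α, integ_mul_poisson φ q ψ,
    integ_mul_poisson φ (lap ψ) ψ, mul_comm (poisson φ ξ), integ_mul_poisson (lap ξ) φ ξ,
    integ_mul_poisson γ φ ρ, hn φ γ ρ, hn τ ξ γ, integ_mul_poisson τ γ ξ,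
    integ_mul_poisson γ φ ξ, mul_comm (lap ψ), hn r ρ ψ, hn c ξ ψ]
  ring

end Weak

/-! ### The Euler–Arnold equation for general κ. -/

section EulerArnold

theorem integ_const_of_hasDerivAt_poisson {J : Set ℝ} (hJ : IsOpen J) (hJ' : J.OrdConnected)
    {ξ ψ : ℝ → SmoothFn} (hξ : SmoothAmbient J ξ)
    (h : ∀ t ∈ J, ∀ x, HasDerivAt (fun s => ξ s x) (poisson (ξ t) (ψ t) x) t) :
    ∀ s ∈ J, ∀ t ∈ J, integ (ξ s) = integ (ξ t) := by
  have hd : ∀ t ∈ J, HasFDerivAt (fun s => integ (ξ s)) (0 : ℝ →L[ℝ] ℝ) t := by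
    intro t ht
    have h1 := (hξ.forall_hasDerivAt_iff hJ ht _).1 (h t ht) 1
    simp only [one_mul, integ_poisson] at h1
    simpa using! h1.hasFDerivAt
  intro s hs t ht
  exact hJ.is_const_of_fderiv_eq_zero hJ'.isPreconnected
    (fun z hz => (hd z hz).differentiableAt.differentiableWithinAt)
    (fun z hz => (hd z hz).fderiv) hs ht

/-- A smooth time-dependent function with constant mean satisfies `∂ₜ ξ = f`, `∫ f = 0`, if it does
so tested against Laplacians. -/
theorem hasDerivAt_of_forall_integ_mul_lap {J : Set ℝ} (hJ : IsOpen J) {ξ : ℝ → SmoothFn}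
    (hξ : SmoothAmbient J ξ) (hc : ∀ s ∈ J, ∀ t ∈ J, integ (ξ s) = integ (ξ t)) {t : ℝ}
    (ht : t ∈ J) {f : SmoothFn} (hf : integ f = 0)
    (h : ∀ χ, HasDerivAt (fun s => integ (lap χ * ξ s)) (integ (lap χ * f)) t) (x : S2) :
    HasDerivAt (fun s => ξ s x) (f x) t := by
  obtain ⟨u', h1, h2⟩ := hξ.exists_hasDerivAt hJ ht
  have h3 : integ u' = 0 := by
    have h4 := h2 1
    simp only [one_mul] at h4
    refine h4.unique ((hasDerivAt_const t (integ (ξ t))).congr_of_eventuallyEq ?_)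
    filter_upwards [hJ.mem_nhds ht] with s hs
    exact hc s hs t ht
  have h5 : u' - f = 0 := by
    -- The error w = u' − f has mean zero and is orthogonal to all Laplacians; testing with its own
    -- Laplacian gives ∫ w Δw = 0.
    refine eq_zero_of_integ_mul_lap ?_ (by rw [map_sub, h3, hf, sub_zero])
    rw [mul_comm, mul_sub, map_sub, (h2 _).unique (h _), sub_self]
  rw [← sub_eq_zero.1 h5]
  exact h1 x

/-- Only the Hamiltonian fields of the velocity are prescribed, as `X_ψ` and `X_ξ`; α and γ stay
free so that both parts of the theorem are instances. -/
theorem isEulerArnoldCurve_iff {J : Set ℝ} (hJ : IsOpen J) (hJ' : J.OrdConnected) {κ : ℝ}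
    (hκ : κ ≠ 0) {ψ ρ q ξ : ℝ → SmoothFn} (hψ : SmoothAmbient J ψ) (hρ : SmoothAmbient J ρ)
    (hq : SmoothAmbient J q) (hξ : SmoothAmbient J ξ) (α γ : ℝ → SmoothFn) :
    (IsEulerArnoldCurve J
        (fun t => (AbelianExt.mk (ham (ξ t)) (ρ t), inertiaOp κ (AbelianExt.mk (ham (ψ t)) (q t))))
        (fun t => MagneticExt.mk (AbelianExt.mk (ham (ψ t)) (α t))
          (inertiaOp κ (AbelianExt.mk (ham (ξ t)) (γ t)))) ∧
      ∀ s ∈ J, ∀ t ∈ J, integ (ξ s) = integ (ξ t)) ↔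
    ∀ t ∈ J, ∀ x,
      HasDerivAt (fun s => lap (ψ s) x)
        ((poisson (lap (ψ t)) (ψ t) + poisson (ξ t) (lap (ξ t)) + κ • (poisson (α t) (q t)
          + poisson (q t) (ψ t) + poisson (γ t) (ρ t) + poisson (ξ t) (γ t))) x) t ∧
      HasDerivAt (fun s => ρ s x)
        ((poisson (ρ t) (ψ t) + poisson (ξ t) (α t) + poisson (ψ t) (ξ t)) x) t ∧
      HasDerivAt (fun s => q s x) ((poisson (q t) (ψ t) + poisson (ξ t) (γ t)) x) t ∧
      HasDerivAt (fun s => ξ s x) (poisson (ξ t) (ψ t) x) t := by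
  constructor
  · rintro ⟨h, hc⟩ t ht
    -- Testers with second component I₁(`X_χ`, r) already suffice: they realise c = −Δχ, and setting
    -- three of φ, τ, r, χ to zero isolates each equation.
    have key : ∀ φ τ r χ : SmoothFn,
        HasDerivAt (fun s => κ * integ (τ * q s) - integ (φ * lap (ψ s)) + integ (r * ρ s)
          + integ (-lap χ * ξ s))
        (κ * integ (τ * (poisson (q t) (ψ t) + poisson (ξ t) (γ t)))
          - integ (φ * (poisson (lap (ψ t)) (ψ t) + poisson (ξ t) (lap (ξ t))
            + κ • (poisson (α t) (q t) + poisson (q t) (ψ t) + poisson (γ t) (ρ t)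
              + poisson (ξ t) (γ t))))
          + integ (r * (poisson (ρ t) (ψ t) + poisson (ξ t) (α t) + poisson (ψ t) (ξ t)))
          + integ (-lap χ * poisson (ξ t) (ψ t))) t := by
      intro φ τ r χ
      have h2 : ∀ ξ ρ : SmoothFn, (inertiaOp 1 (AbelianExt.mk (ham χ) r) : Module.Dual ℝ AbelianExt)
          (AbelianExt.mk (ham ξ) ρ) = integ (r * ρ) + integ (-lap χ * ξ) := by
        intro ξ ρ
        refine (inertia_ham 1 χ r ξ ρ).trans ?_
        rw [neg_mul, map_neg, integ_mul_lap_comm, mul_comm (lap χ), integ_mul_lap_comm]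
        ring
      have h3 := h t ht (MagneticExt.mk (AbelianExt.mk (ham φ) τ)
        (inertiaOp 1 (AbelianExt.mk (ham χ) r)))
      rw [pairing_lie_ham (y := MagneticExt.mk (AbelianExt.mk (ham φ) τ)
        (inertiaOp 1 (AbelianExt.mk (ham χ) r))) (φ := φ) (τ := τ) (r := r) (c := -lap χ)
        rfl h2] at h3
      refine h3.congr_of_eventuallyEq (.of_forall fun s => ?_)
      exact (pairing_ham (y := MagneticExt.mk (AbelianExt.mk (ham φ) τ)
        (inertiaOp 1 (AbelianExt.mk (ham χ) r))) (φ := φ) (τ := τ) (r := r) (c := -lap χ)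
        rfl h2).symm
    have hl0 : lap 0 = 0 := by simp [lap]
    have hP := (hψ.lap hJ).forall_hasDerivAt_iff hJ ht
      (poisson (lap (ψ t)) (ψ t) + poisson (ξ t) (lap (ξ t)) + κ • (poisson (α t) (q t)
          + poisson (q t) (ψ t) + poisson (γ t) (ρ t) + poisson (ξ t) (γ t)))
    have hR := hρ.forall_hasDerivAt_iff hJ ht
      (poisson (ρ t) (ψ t) + poisson (ξ t) (α t) + poisson (ψ t) (ξ t))
    have hQ := hq.forall_hasDerivAt_iff hJ ht (poisson (q t) (ψ t) + poisson (ξ t) (γ t))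
    refine fun x => ⟨hP.2 (fun g => ?_) x, hR.2 (fun g => ?_) x, hQ.2 (fun g => ?_) x,
      hasDerivAt_of_forall_integ_mul_lap hJ hξ hc ht (integ_poisson _ _) (fun g => ?_) x⟩
    · have e := (key g 0 0 0).neg
      simp only [hl0, neg_zero, zero_mul, map_zero, mul_zero, zero_sub, add_zero, neg_neg] at e
      exact e.congr_of_eventuallyEq (.of_forall fun s => by simp)
    · have e := key 0 0 g 0
      simpa only [hl0, neg_zero, zero_mul, map_zero, mul_zero, sub_zero, add_zero, zero_add] using e
    · have e := (key 0 g 0 0).const_mul κ⁻¹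
      simpa only [hl0, neg_zero, zero_mul, map_zero, mul_zero, sub_zero, add_zero,
        inv_mul_cancel_left₀ hκ] using e
    · have e := (key 0 0 0 g).neg
      simp only [neg_mul, zero_mul, map_zero, map_neg, mul_zero, sub_zero, zero_add, neg_neg] at e
      exact e.congr_of_eventuallyEq (.of_forall fun s => by simp)
  · intro h
    -- Conversely an arbitrary tester is reduced to four scalar functions, and the four weak
    -- equations add up.
    choose stream hstream using exists_ham
    choose r c h2 using smoothDual_ham
    refine ⟨fun t ht y => ?_, integ_const_of_hasDerivAt_poisson hJ hJ' hξ
      fun t ht x => (h t ht x).2.2.2⟩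
    have h1 : y.fst = AbelianExt.mk (ham (stream y.fst.vf)) y.fst.fn := by
      rw [← hstream]; rfl
    have eP := ((hψ.lap hJ).forall_hasDerivAt_iff hJ ht _).1 (fun x => (h t ht x).1)
      (stream y.fst.vf)
    have eR := (hρ.forall_hasDerivAt_iff hJ ht _).1 (fun x => (h t ht x).2.1) (r y.snd)
    have eQ := (hq.forall_hasDerivAt_iff hJ ht _).1 (fun x => (h t ht x).2.2.1) y.fst.fn
    have eX := (hξ.forall_hasDerivAt_iff hJ ht _).1 (fun x => (h t ht x).2.2.2) (c y.snd)
    rw [pairing_lie_ham h1 (h2 y.snd)]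
    exact ((((eQ.const_mul κ).sub eP).add eR).add eX).congr_of_eventuallyEq
      (.of_forall fun s => pairing_ham h1 (h2 y.snd))

end EulerArnold

/-! ### The quadratic Hamiltonian and its differential. -/

section LiePoisson

theorem inertia_comm (κ : ℝ) (x y : AbelianExt) : inertia κ x y = inertia κ y x := by
  simp only [inertia, LinearMap.mk₂_apply, mul_comm]

theorem inertia_self_eq_zero {κ : ℝ} (hκ : 0 < κ) {x : AbelianExt} (h : inertia κ x x = 0) :
    x = 0 := by
  simp only [inertia, LinearMap.mk₂_apply, map_add, map_smul, smul_eq_mul, map_sum] at h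
  have hn : ∀ f : SmoothFn, 0 ≤ integ (f * f) := fun f => integ_nonneg fun x => mul_self_nonneg (f x)
  have h1 := hn x.fn
  have h2 : 0 ≤ ∑ i, integ (comp x.vf i * comp x.vf i) := Finset.sum_nonneg fun i _ => hn _
  have h3 : ∑ i, integ (comp x.vf i * comp x.vf i) = 0 := by nlinarith
  have h4 : integ (x.fn * x.fn) = 0 := by
    rw [h3, add_zero, mul_eq_zero] at h
    exact h.resolve_left hκ.ne'
  have hf : x.fn = 0 := eq_zero_of_integ_sq h4
  have hv : x.vf = 0 := divFree_ext fun i => by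
    rw [eq_zero_of_integ_sq ((Finset.sum_eq_zero_iff_of_nonneg fun i _ => hn _).1 h3 i
      (Finset.mem_univ i))]
    rfl
  have hx : x = AbelianExt.mk x.vf x.fn := rfl
  rw [hx, hf, hv]
  rfl

theorem inertia_self_nonneg {κ : ℝ} (hκ : 0 ≤ κ) (x : AbelianExt) : 0 ≤ inertia κ x x := by
  simp only [inertia, LinearMap.mk₂_apply, map_add, map_smul, smul_eq_mul, map_sum]
  have hn : ∀ f : SmoothFn, 0 ≤ integ (f * f) := fun f => integ_nonneg fun x => mul_self_nonneg (f x)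
  exact add_nonneg (mul_nonneg hκ (hn _)) (Finset.sum_nonneg fun i _ => hn _)

/-- The Legendre transform of `v ↦ ½ ⟨I v, v⟩`, where `I = inertia 4`. -/
noncomputable def legendre (b : Module.Dual ℝ AbelianExt) : ℝ :=
  ⨆ v : AbelianExt, (b v - 1 / 2 * inertia 4 v v)

/-- Young's inequality under the integral; representability of b by smooth r and a is what gives a
finite bound. -/
theorem bddAbove_legendre (b : smoothDual) : BddAbove (Set.range fun v : AbelianExt =>
    (b : Module.Dual ℝ AbelianExt) v - 1 / 2 * inertia 4 v v) := by
  obtain ⟨b, r, a, h⟩ := b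
  refine ⟨integ (r * r + ∑ i, a i * a i), ?_⟩
  rintro _ ⟨v, rfl⟩
  change b v - 1 / 2 * inertia 4 v v ≤ _
  simp only [inertia, LinearMap.mk₂_apply]
  rw [h, ← smul_eq_mul (a := (1 / 2 : ℝ)), ← map_smul, ← map_sub]
  refine integ_mono fun x => ?_
  simp [Fin.sum_univ_three]
  nlinarith [sq_nonneg (r x - v.fn x), sq_nonneg (a 0 x - comp v.vf 0 x),
    sq_nonneg (a 1 x - comp v.vf 1 x), sq_nonneg (a 2 x - comp v.vf 2 x),
    sq_nonneg (r x), sq_nonneg (v.fn x), sq_nonneg (a 0 x), sq_nonneg (a 1 x), sq_nonneg (a 2 x)]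

theorem legendre_zero : legendre 0 = 0 := by
  have h := fun v => inertia_self_nonneg (κ := 4) (by norm_num) v
  refine le_antisymm (ciSup_le fun v => ?_) (le_ciSup_of_le ⟨0, ?_⟩ 0 (by simp))
  · simp only [LinearMap.zero_apply]
    linarith [h v]
  · rintro _ ⟨v, rfl⟩
    simp only [LinearMap.zero_apply]
    linarith [h v]

theorem legendre_smul (b : Module.Dual ℝ AbelianExt) (s : ℝ) :
    legendre (s • b) = s ^ 2 * legendre b := by
  by_cases hs : s = 0
  · subst hs
    simp [legendre_zero]
  -- Substitute v ↦ s v. No boundedness is required, since the real supremum of an unbounded family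
  -- is 0 by convention on both sides.
  · rw [legendre, legendre, Real.mul_iSup_of_nonneg (sq_nonneg s)]
    refine ((Equiv.smulRight hs).surjective.iSup_comp
      (g := fun v : AbelianExt => (s • b) v - 1 / 2 * inertia 4 v v)).symm.trans ?_
    congr 1
    funext v
    simp only [Equiv.smulRight_apply, map_smul, LinearMap.smul_apply, smul_eq_mul]
    ring

/-- Completing the square by the translation v ↦ u + v. Since b is arbitrary, perturbations need not
lie in the image of the inertia operator. -/
theorem legendre_inertia_add (u : AbelianExt) (b : smoothDual) :
    legendre (inertia 4 u + (b : Module.Dual ℝ AbelianExt))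
      = 1 / 2 * inertia 4 u u + (b : Module.Dual ℝ AbelianExt) u
        + legendre (b : Module.Dual ℝ AbelianExt) := by
  rw [legendre, legendre, add_ciSup (bddAbove_legendre b)]
  refine ((Equiv.addLeft u).surjective.iSup_comp
    (g := fun v : AbelianExt => (inertia 4 u + (b : Module.Dual ℝ AbelianExt)) v
      - 1 / 2 * inertia 4 v v)).symm.trans ?_
  congr 1
  funext v
  simp only [Equiv.coe_addLeft, map_add, LinearMap.add_apply, inertia_comm 4 v u]
  ring

theorem hamiltonian_add (w u : AbelianExt) (δ : MagneticDual) (s : ℝ) :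
    hamiltonian ((w, inertiaOp 4 u) + s • δ)
      = 1 / 2 * inertia 4 w w + 1 / 2 * inertia 4 u u
        + s * ((δ.2 : Module.Dual ℝ AbelianExt) u + inertia 4 w δ.1)
        + s ^ 2 * (1 / 2 * inertia 4 δ.1 δ.1 + legendre (δ.2 : Module.Dual ℝ AbelianExt)) := by
  have h1 : hamiltonian ((w, inertiaOp 4 u) + s • δ)
      = 1 / 2 * inertia 4 (w + s • δ.1) (w + s • δ.1)
        + legendre (inertia 4 u + s • (δ.2 : Module.Dual ℝ AbelianExt)) := rfl
  have h2 : legendre (inertia 4 u + s • (δ.2 : Module.Dual ℝ AbelianExt))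
      = 1 / 2 * inertia 4 u u + s * (δ.2 : Module.Dual ℝ AbelianExt) u
        + s ^ 2 * legendre (δ.2 : Module.Dual ℝ AbelianExt) := by
    rw [← legendre_smul]
    exact legendre_inertia_add u (s • δ.2)
  have h3 : inertia 4 (w + s • δ.1) (w + s • δ.1)
      = inertia 4 w w + 2 * s * inertia 4 w δ.1 + s ^ 2 * inertia 4 δ.1 δ.1 := by
    simp only [map_add, map_smul, LinearMap.add_apply, LinearMap.smul_apply, smul_eq_mul,
      inertia_comm 4 δ.1 w]
    ring
  refine h1.trans ((congrArg₂ (fun a b : ℝ => 1 / 2 * a + b) h3 h2).trans ?_)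
  have h4 : ∀ A B C E F G : ℝ, 1 / 2 * (A + 2 * s * B + s ^ 2 * C) + (1 / 2 * E + s * F + s ^ 2 * G)
      = 1 / 2 * A + 1 / 2 * E + s * (F + B) + s ^ 2 * (1 / 2 * C + G) := by
    intros
    ring
  exact h4 _ _ _ _ _ _

theorem isDifferentialAt_hamiltonian (w u : AbelianExt) :
    IsDifferentialAt hamiltonian (w, inertiaOp 4 u) (MagneticExt.mk u (inertiaOp 4 w)) := by
  intro δ
  have key : ∀ c a b : ℝ, HasDerivAt (fun s : ℝ => c + s * a + s ^ 2 * b) a 0 := fun c a b => by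
    simpa using! (((hasDerivAt_id (0 : ℝ)).mul_const a).const_add c).add
      (((hasDerivAt_id (0 : ℝ)).pow 2).mul_const b)
  exact (key (1 / 2 * inertia 4 w w + 1 / 2 * inertia 4 u u)
    ((δ.2 : Module.Dual ℝ AbelianExt) u + inertia 4 w δ.1)
    (1 / 2 * inertia 4 δ.1 δ.1 + legendre (δ.2 : Module.Dual ℝ AbelianExt))).congr_of_eventuallyEq
    (.of_forall fun s => hamiltonian_add w u δ s)

/-- The pairing separates points: testing with (0, I(x.fst − u)) forces the first components to
agree by definiteness of I, and testing with (v, 0) recovers the second. -/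
theorem IsDifferentialAt.eq {w u : AbelianExt} {x : MagneticExt}
    (h : IsDifferentialAt hamiltonian (w, inertiaOp 4 u) x) :
    x = MagneticExt.mk u (inertiaOp 4 w) := by
  have hp := fun δ => (h δ).unique (isDifferentialAt_hamiltonian w u δ)
  have h1 : x.fst - u = 0 := by
    refine inertia_self_eq_zero (κ := 4) (by norm_num) ?_
    have h2 : inertia 4 (x.fst - u) x.fst + (x.snd : Module.Dual ℝ AbelianExt) 0
      = inertia 4 (x.fst - u) u + (inertia 4 w) 0 := hp (0, inertiaOp 4 (x.fst - u))
    rw [map_zero, map_zero, add_zero, add_zero] at h2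
    rw [map_sub (inertia 4 (x.fst - u)), h2, sub_self]
  have h3 : x.snd = inertiaOp 4 w := by
    apply Subtype.ext
    ext v
    have h4 : ((0 : smoothDual) : Module.Dual ℝ AbelianExt) x.fst
        + (x.snd : Module.Dual ℝ AbelianExt) v
      = ((0 : smoothDual) : Module.Dual ℝ AbelianExt) u + (inertia 4 w) v := hp (v, 0)
    have h0 : ∀ z, ((0 : smoothDual) : Module.Dual ℝ AbelianExt) z = 0 := fun _ => rfl
    rw [h0, h0, zero_add, zero_add] at h4
    exact h4
  have hx : x = MagneticExt.mk x.fst x.snd := rfl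
  rw [hx, h3, sub_eq_zero.1 h1]

theorem hamiltonian_eq (w u : AbelianExt) :
    hamiltonian (w, inertiaOp 4 u) = 1 / 2 * inertia 4 w w + 1 / 2 * inertia 4 u u := by
  have h := legendre_inertia_add u 0
  have h0 : ((0 : smoothDual) : Module.Dual ℝ AbelianExt) = 0 := rfl
  rw [h0, add_zero, legendre_zero, LinearMap.zero_apply, add_zero, add_zero] at h
  exact congrArg (fun z => 1 / 2 * inertia 4 w w + z) h

theorem hamiltonian_momentum (ψ ρ q ξ : SmoothFn) :
    hamiltonian (momentum ψ ρ q ξ) = energy ψ ρ q ξ := by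
  rw [momentum, hamiltonian_eq, inertia_ham, inertia_ham, energy]
  simp only [smul_mul_smul_comm, map_smul, map_sub, smul_eq_mul, sq]
  ring

/-- Uniqueness of the differential removes the existential quantifier over `x`. -/
theorem isLiePoissonCurve_iff (J : Set ℝ) (w u : ℝ → AbelianExt) :
    IsLiePoissonCurve hamiltonian J (fun t => (w t, inertiaOp 4 (u t))) ↔
      IsEulerArnoldCurve J (fun t => (w t, inertiaOp 4 (u t)))
        (fun t => MagneticExt.mk (u t) (inertiaOp 4 (w t))) := by
  constructor
  · intro h t ht y
    exact (h.choose_spec.2 t ht y).congr_deriv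
      (congrArg (fun z => pairing (w t, inertiaOp 4 (u t)) ⁅z, y⁆) (h.choose_spec.1 t ht).eq)
  · exact fun h => ⟨_, fun t _ => isDifferentialAt_hamiltonian _ _, h⟩

end LiePoisson

/-! ### Matching coefficients with the MHD system. -/

section Main

theorem hasDerivAt_half_smul_iff {u : ℝ → SmoothFn} {f g : SmoothFn} (h : f = (1 / 2 : ℝ) • g)
    {x : S2} {t : ℝ} : HasDerivAt (fun s => ((1 / 2 : ℝ) • u s) x) (f x) t ↔
      HasDerivAt (fun s => u s x) (g x) t := by
  subst h
  constructor
  · intro h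
    simpa using h.const_mul 2
  · intro h
    simpa using h.const_mul (1 / 2 : ℝ)

/-- With α and γ equal to the halved fields the brackets {α, q/2} and {γ, ρ/2} vanish, and 4 · ½
gives the coefficient 2 in the first equation. Doubling the ρ equation turns its cocycle term into
2{ψ, ξ}. -/
theorem solves_iff_half {J : Set ℝ} (ψ ρ q ξ : ℝ → SmoothFn) :
    SolvesAxisymmetricMHD J ψ ρ q ξ ↔ ∀ t ∈ J, ∀ x,
      HasDerivAt (fun s => lap (ψ s) x)
        ((poisson (lap (ψ t)) (ψ t) + poisson (ξ t) (lap (ξ t))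
          + (4 : ℝ) • (poisson ((1 / 2 : ℝ) • q t) ((1 / 2 : ℝ) • q t)
          + poisson ((1 / 2 : ℝ) • q t) (ψ t) + poisson ((1 / 2 : ℝ) • ρ t) ((1 / 2 : ℝ) • ρ t)
          + poisson (ξ t) ((1 / 2 : ℝ) • ρ t))) x) t ∧
      HasDerivAt (fun s => ((1 / 2 : ℝ) • ρ s) x)
        ((poisson ((1 / 2 : ℝ) • ρ t) (ψ t) + poisson (ξ t) ((1 / 2 : ℝ) • q t)
          + poisson (ψ t) (ξ t)) x) t ∧
      HasDerivAt (fun s => ((1 / 2 : ℝ) • q s) x)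
        ((poisson ((1 / 2 : ℝ) • q t) (ψ t) + poisson (ξ t) ((1 / 2 : ℝ) • ρ t)) x) t ∧
      HasDerivAt (fun s => ξ s x) (poisson (ξ t) (ψ t) x) t := by
  refine forall₂_congr fun t _ => forall_congr' fun x => ?_
  refine and_congr ?_ (and_congr ?_ (and_congr ?_ Iff.rfl))
  · have e : poisson (lap (ψ t)) (ψ t) + poisson (ξ t) (lap (ξ t))
          + (4 : ℝ) • (poisson ((1 / 2 : ℝ) • q t) ((1 / 2 : ℝ) • q t)
          + poisson ((1 / 2 : ℝ) • q t) (ψ t) + poisson ((1 / 2 : ℝ) • ρ t) ((1 / 2 : ℝ) • ρ t)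
          + poisson (ξ t) ((1 / 2 : ℝ) • ρ t))
        = poisson (lap (ψ t)) (ψ t) + poisson (ξ t) (lap (ξ t)) + 2 * poisson (q t) (ψ t)
          + 2 * poisson (ξ t) (ρ t) := by
      simp only [poisson_self, poisson_smul_left (1 / 2) (q t) (ψ t), poisson_smul_right, zero_add,
        add_zero, smul_add, smul_smul]
      norm_num
      simp only [ofNat_smul_eq_nsmul, nsmul_eq_mul, add_assoc]
      norm_num
    rw [e]
  · refine (hasDerivAt_half_smul_iff ?_).symm
    rw [poisson_smul_left, poisson_smul_right, smul_add, smul_add, two_mul (poisson (ψ t) (ξ t)),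
      ← two_smul ℝ (poisson (ψ t) (ξ t)), smul_smul]
    norm_num
  · refine (hasDerivAt_half_smul_iff ?_).symm
    rw [poisson_smul_left, poisson_smul_right, smul_add]

/-- Here the shifts by −ψ and ξ supply a second copy of {q, ψ} and {ψ, ξ}, while {ρ + ξ, ρ} adds a
second {ξ, ρ}. -/
theorem solves_iff {J : Set ℝ} (ψ ρ q ξ : ℝ → SmoothFn) :
    SolvesAxisymmetricMHD J ψ ρ q ξ ↔ ∀ t ∈ J, ∀ x,
      HasDerivAt (fun s => lap (ψ s) x)
        ((poisson (lap (ψ t)) (ψ t) + poisson (ξ t) (lap (ξ t))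
          + (1 : ℝ) • (poisson (q t - ψ t) (q t) + poisson (q t) (ψ t)
          + poisson (ρ t + ξ t) (ρ t) + poisson (ξ t) (ρ t + ξ t))) x) t ∧
      HasDerivAt (fun s => ρ s x)
        ((poisson (ρ t) (ψ t) + poisson (ξ t) (q t - ψ t) + poisson (ψ t) (ξ t)) x) t ∧
      HasDerivAt (fun s => q s x)
        ((poisson (q t) (ψ t) + poisson (ξ t) (ρ t + ξ t)) x) t ∧
      HasDerivAt (fun s => ξ s x) (poisson (ξ t) (ψ t) x) t := by
  refine forall₂_congr fun t _ => forall_congr' fun x => ?_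
  have e1 : poisson (lap (ψ t)) (ψ t) + poisson (ξ t) (lap (ξ t))
          + (1 : ℝ) • (poisson (q t - ψ t) (q t) + poisson (q t) (ψ t)
          + poisson (ρ t + ξ t) (ρ t) + poisson (ξ t) (ρ t + ξ t))
        = poisson (lap (ψ t)) (ψ t) + poisson (ξ t) (lap (ξ t)) + 2 * poisson (q t) (ψ t)
          + 2 * poisson (ξ t) (ρ t) := by
    rw [one_smul, poisson_sub_left, poisson_add_left, poisson_add_right, poisson_self,
      poisson_self, poisson_self, poisson_antisymm (ψ t) (q t)]
    ring
  have e2 : poisson (ρ t) (ψ t) + poisson (ξ t) (q t - ψ t) + poisson (ψ t) (ξ t)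
      = poisson (ρ t) (ψ t) + poisson (ξ t) (q t) + 2 * poisson (ψ t) (ξ t) := by
    rw [poisson_sub_right, poisson_antisymm (ξ t) (ψ t)]
    ring
  have e3 : poisson (q t) (ψ t) + poisson (ξ t) (ρ t + ξ t)
      = poisson (q t) (ψ t) + poisson (ξ t) (ρ t) := by
    rw [poisson_add_right, poisson_self, add_zero]
  rw [e1, e2, e3]

end Main

end AxiMHD

theorem mainTheorem1 (J : Set ℝ) (hJ : IsOpen J) (hJ' : J.OrdConnected)
    (ψ ρ q ξ : ℝ → AxiMHD.SmoothFn)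
    (hψ : AxiMHD.SmoothInTime J ψ) (hρ : AxiMHD.SmoothInTime J ρ)
    (hq : AxiMHD.SmoothInTime J q) (hξ : AxiMHD.SmoothInTime J ξ) :
    (AxiMHD.SolvesAxisymmetricMHD J ψ ρ q ξ ↔
      AxiMHD.IsLiePoissonCurve AxiMHD.hamiltonian J
        (fun t => AxiMHD.momentum (ψ t) (ρ t) (q t) (ξ t)) ∧
      ∀ s ∈ J, ∀ t ∈ J, AxiMHD.integ (ξ s) = AxiMHD.integ (ξ t)) ∧
    (∀ t ∈ J, AxiMHD.hamiltonian (AxiMHD.momentum (ψ t) (ρ t) (q t) (ξ t)) =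
      AxiMHD.energy (ψ t) (ρ t) (q t) (ξ t)) ∧
    (AxiMHD.SolvesAxisymmetricMHD J ψ ρ q ξ ↔
      AxiMHD.IsEulerArnoldCurve J
        (fun t => AxiMHD.coalgebraFields (ψ t) (ρ t) (q t) (ξ t))
        (fun t => AxiMHD.algebraFields (q t - ψ t) (ψ t) (ρ t + ξ t) (ξ t)) ∧
      ∀ s ∈ J, ∀ t ∈ J, AxiMHD.integ (ξ s) = AxiMHD.integ (ξ t)) := by
  have hψ' := hψ.smoothAmbient hJ
  have hρ' := hρ.smoothAmbient hJ
  have hq' := hq.smoothAmbient hJ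
  have hξ' := hξ.smoothAmbient hJ
  refine ⟨?_, fun t _ => AxiMHD.hamiltonian_momentum _ _ _ _, ?_⟩
  · refine (AxiMHD.solves_iff_half ψ ρ q ξ).trans ?_
    refine (AxiMHD.isEulerArnoldCurve_iff hJ hJ' (κ := 4) (by norm_num) hψ'
      (hρ'.const_smul (1 / 2)) (hq'.const_smul (1 / 2)) hξ' (fun t => (1 / 2 : ℝ) • q t)
      (fun t => (1 / 2 : ℝ) • ρ t)).symm.trans (and_congr_left' ?_)
    exact (AxiMHD.isLiePoissonCurve_iff J _ _).symm
  · refine (AxiMHD.solves_iff ψ ρ q ξ).trans ?_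
    exact (AxiMHD.isEulerArnoldCurve_iff hJ hJ' (κ := 1) one_ne_zero hψ' hρ' hq' hξ'
      (fun t => q t - ψ t) (fun t => ρ t + ξ t)).symm
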